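/- **Setting.** Let $\mathbb F=\mathbb R$ or $\mathbb C$, $m,n\ge 0$, and let $X^*$ be the conjugate transpose of $X$ (the transpose if $\mathbb F=\mathbb R$). Write $\mathcal U(n)$ for the unitary group over $\mathbb F$ (the orthogonal group if $\mathbb F=\mathbb R$), $\mathcal{SL}(n)$ for the special linear group, and $\mathcal{UUT}(n)$, $\mathcal{LUT}(n)$ for the groups of upper, respectively lower, triangular matrices with unit diagonal. A rectangular matrix $D$ is *diagonal* if $d_{ij}=0$ for $i\ne j$, and *upper triangular* if $d_{ij}=0$ for $i>j$. For a group $\mathfrak G$ of pairs $(G_1,G_2)$ of invertible matrices and a cost $\phi$, consider $$\inf_{(G_1,G_2)\in\mathfrak G}\phi(G_2MG_1^\top).\qquad(*)$$ A *minimizer* is a pair in $\mathfrak G$ at which this infimum is attained; it yields the decomposition $M=G_2^{-1}(G_2MG_1^\top)G_1^{-\top}$. For $f:\mathbb R\to\mathbb R$ put $\phi_f(X)=\sum_{i,j}f(|x_{ij}|)$ and $\psi_f(X)=\sum_{i,j}f(|x_{ij}\mathbb 1_{\{i>j\}}|)$. **Theorem.** The groups of Kronecker products $G_1\otimes G_2$,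 $(G_1,G_2)\in\mathfrak G$, for the groups $\mathfrak G$ below, are unit groups (all determinants have modulus $1$), and the following hold. 1. *SVD (real and complex).* Let $\mathfrak G=\{(\overline V,U):U\in\mathcal U(m),V\in\mathcal U(n)\}$, $\phi=\phi_f$ with $x\mapsto f(\sqrt x)$ strictly concave on $[0,\infty)$ and $f(0)\ge 0$, and $M\in\mathbb F^{m\times n}$. Then $M=USV^*$ for some $U\in\mathcal U(m)$, $V\in\mathcal U(n)$ and a diagonal $S$ with real nonnegative entries. Whenever $M=UDV^*$ with $U\in\mathcal U(m)$, $V\in\mathcal U(n)$ and $D$ diagonal, $(\overline V,U)^{-1}$ is a minimizer of $(*)$; and for every minimizer $(\overline{V'},U')^{-1}$ there are permutation matrices $P,P'$ and a diagonal $Z$ with $|Z|=|D|$ entrywise and $M=(U'P)Z(V'P')^*$. 2. *QR.* Let $\mathfrak G=\{(R^\top,Q):Q\in\mathcal U(m),R\in\mathcal{UUT}(n)\}$, $\phi=\phi_f$ with $x\mapsto f(\sqrt x)$ strictly concave and increasing on $[0,\infty)$ and $f(0)\ge 0$, and $M\in\mathbb F^{m\times n}$. If $n\le m$, then $M=QDR$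 for some $Q\in\mathcal U(m)$, $R\in\mathcal{UUT}(n)$ and $D$ diagonal. For all $m,n$, whenever $M=QDR$ is such a decomposition, $(R^\top,Q)^{-1}$ is a minimizer of $(*)$; and for every minimizer $(R'^\top,Q')^{-1}$ there are a permutation matrix $P$ and a diagonal $Z$ with $|Z|=|D|$ entrywise and $M=(Q'P)ZR'$. 3. *Matrix equivalence.* Let $\mathfrak G=\{(Q^\top,P):P,Q\in\mathcal{SL}(n)\}$, $\phi=\phi_f$ with $x\mapsto f(\sqrt x)$ strictly concave and increasing on $[0,\infty)$, $x\mapsto f(\sqrt{e^x})$ convex on $\mathbb R$ and $f(0)\ge 0$, and let $M\in\mathbb F^{n\times n}$ be invertible. Then $M=PDQ$ for some $P,Q\in\mathcal{SL}(n)$ and $D$ diagonal with $|d_{ii}|^n=|\det M|$ for all $i$; moreover, for every $c\in\mathbb F$ with $c^n=\det M$ there is such a decomposition with $D=cI$. For every decomposition $M=PDQ$ with $P,Q\in\mathcal{SL}(n)$ and $D$ diagonal with $|d_{ii}|^n=|\det M|$ for all $i$, $(Q^\top,P)^{-1}$ is a minimizer of $(*)$. For every minimizer $(Q^\top,P)^{-1}$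 there are $W\in\mathcal{SL}(n)$ with $|W|$ a permutation matrix and a diagonal $D$ with $M=(PW)DQ$; if $x\mapsto f(\sqrt{e^x})$ is strictly convex, then $|d_{ii}|^n=|\det M|$ for all $i$. In 4–6, $\phi=\psi_f$, where $f\ge 0$ on $[0,\infty)$ and, for $x\ge 0$, $f(x)=0$ if and only if $x=0$. 4. *LU.* Let $\mathfrak G=\{(I,L):L\in\mathcal{LUT}(m)\}$ and $M\in\mathbb F^{m\times n}$. If $M$ has a factorization $M=LT$ with $L\in\mathcal{LUT}(m)$ and $T$ upper triangular, then, for $L'\in\mathcal{LUT}(m)$, $(I,L')^{-1}$ is a minimizer of $(*)$ if and only if $M=L'T'$ for some upper triangular $T'$. If $M=LDU$ with $L\in\mathcal{LUT}(m)$, $D$ diagonal and $U\in\mathcal{UUT}(n)$, then $(I,L)^{-1}$ is a minimizer, and $M=L'DU$ for every minimizer $(I,L')^{-1}$. 5. *Cholesky.* Let $\mathfrak G=\{(I,L):L\in\mathcal{LUT}(n)\}$ and let $M\in\mathbb F^{n\times n}$ be (Hermitian) positive definite. Then $(*)$ has a minimizer, and, for $L\in\mathcal{LUT}(n)$, $(I,L)^{-1}$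 is a minimizer if and only if $M=LDL^*$ for some diagonal $D$ with positive real diagonal entries. 6. *Schur.* Let $\mathbb F=\mathbb C$, $\mathfrak G=\{(\overline Q,Q):Q\in\mathcal U(n)\}$ and $M\in\mathbb C^{n\times n}$. Then $(*)$ has a minimizer, and, for $Q\in\mathcal U(n)$, $(\overline Q,Q)^{-1}$ is a minimizer if and only if $M=QTQ^*$ for some upper triangular $T$. -/

import Mathlib

open Matrix
open scoped Kronecker ComplexOrder

namespace GOO

noncomputable section

variable {𝕜 : Type*} [RCLike 𝕜]

/-! ### Shapes of matrices -/

/-- Rectangular diagonal matrices: all entries off the main diagonal vanish. -/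
def IsRectDiag {m n : ℕ} (D : Matrix (Fin m) (Fin n) 𝕜) : Prop :=
  ∀ (i : Fin m) (j : Fin n), (i : ℕ) ≠ (j : ℕ) → D i j = 0

/-- Upper triangular (for rectangular matrices: upper trapezoidal) matrices. -/
def IsUpperTri {m n : ℕ} (T : Matrix (Fin m) (Fin n) 𝕜) : Prop :=
  ∀ (i : Fin m) (j : Fin n), (j : ℕ) < (i : ℕ) → T i j = 0

/-- `W` has the entrywise absolute values of a permutation matrix. -/
def IsUnimodularMonomial {n : ℕ} (W : Matrix (Fin n) (Fin n) 𝕜) : Prop :=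
  ∃ σ : Equiv.Perm (Fin n), ∀ i j, ‖W i j‖ = ‖σ.permMatrix 𝕜 i j‖

/-! ### Matrix groups -/

/-- A matrix group is a unit group if all its elements have determinant of modulus one. -/
def IsUnitGroup {ι : Type*} [Fintype ι] [DecidableEq ι] (G : Subgroup (GL ι 𝕜)) : Prop :=
  ∀ g ∈ G, ‖(g : Matrix ι ι 𝕜).det‖ = 1

/-- The unitary group (the orthogonal group if `𝕜 = ℝ`), inside the general linear group. -/
def unitaryGL (𝕜 : Type*) [RCLike 𝕜] (n : ℕ) : Subgroup (GL (Fin n) 𝕜) :=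
  (Matrix.unitaryGroup (Fin n) 𝕜).units

/-- The special linear group, inside the general linear group. -/
def specialGL (𝕜 : Type*) [RCLike 𝕜] (n : ℕ) : Subgroup (GL (Fin n) 𝕜) :=
  (Matrix.GeneralLinearGroup.det : GL (Fin n) 𝕜 →* 𝕜ˣ).ker

lemma upper_mul_diag {n : ℕ} {A B : Matrix (Fin n) (Fin n) 𝕜} (hA : IsUpperTri A)
    (hB : IsUpperTri B) (i : Fin n) : (A * B) i i = A i i * B i i := by
  rw [Matrix.mul_apply]
  refine Finset.sum_eq_single i (fun k _ hk => ?_) (by simp)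
  rcases lt_or_gt_of_ne hk with h | h
  · rw [hA i k h, zero_mul]
  · rw [hB k i h, mul_zero]

lemma upper_inv {n : ℕ} {g : GL (Fin n) 𝕜} (hg : IsUpperTri (g : Matrix (Fin n) (Fin n) 𝕜)) :
    IsUpperTri ((g⁻¹ : GL (Fin n) 𝕜) : Matrix (Fin n) (Fin n) 𝕜) := by
  let _ : Invertible (g : Matrix (Fin n) (Fin n) 𝕜) := g.invertible
  have h : Matrix.BlockTriangular (g : Matrix (Fin n) (Fin n) 𝕜) id := fun i j hij => hg i j hij
  have h2 := Matrix.blockTriangular_inv_of_blockTriangular h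
  rw [Matrix.coe_units_inv]
  exact fun i j hij => h2 hij

/-- The group of upper triangular matrices with all diagonal entries equal to one. -/
def upperUnitGL (𝕜 : Type*) [RCLike 𝕜] (n : ℕ) : Subgroup (GL (Fin n) 𝕜) where
  carrier := {g | IsUpperTri (g : Matrix (Fin n) (Fin n) 𝕜) ∧
    ∀ i, (g : Matrix (Fin n) (Fin n) 𝕜) i i = 1}
  one_mem' := ⟨fun i j h => Matrix.one_apply_ne (fun e => by subst e; exact lt_irrefl _ h),
    fun i => Matrix.one_apply_eq i⟩
  mul_mem' := by
    rintro a b ⟨ha, ha'⟩ ⟨hb, hb'⟩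
    have h1 : Matrix.BlockTriangular (a : Matrix (Fin n) (Fin n) 𝕜) id :=
      fun i j hij => ha i j hij
    have h2 : Matrix.BlockTriangular (b : Matrix (Fin n) (Fin n) 𝕜) id :=
      fun i j hij => hb i j hij
    refine ⟨fun i j hij => (h1.mul h2) hij, fun i => ?_⟩
    rw [Units.val_mul, upper_mul_diag ha hb, ha', hb', one_mul]
  inv_mem' := by
    rintro a ⟨ha, ha'⟩
    refine ⟨upper_inv ha, fun i => ?_⟩
    have h := upper_mul_diag ha (upper_inv ha) i
    rw [← Units.val_mul, mul_inv_cancel, Units.val_one, Matrix.one_apply_eq, ha', one_mul] at h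
    exact h.symm

/-- The transpose, as an involution of the set of invertible matrices. -/
def transposeGL {n : ℕ} (g : GL (Fin n) 𝕜) : GL (Fin n) 𝕜 where
  val := (g : Matrix (Fin n) (Fin n) 𝕜)ᵀ
  inv := ((g⁻¹ : GL (Fin n) 𝕜) : Matrix (Fin n) (Fin n) 𝕜)ᵀ
  val_inv := by
    rw [← Matrix.transpose_mul, ← Units.val_mul, inv_mul_cancel, Units.val_one,
      Matrix.transpose_one]
  inv_val := by
    rw [← Matrix.transpose_mul, ← Units.val_mul, mul_inv_cancel, Units.val_one,
      Matrix.transpose_one]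

lemma transposeGL_mul {n : ℕ} (a b : GL (Fin n) 𝕜) :
    transposeGL (a * b) = transposeGL b * transposeGL a :=
  Units.ext (Matrix.transpose_mul _ _)

lemma transposeGL_one {n : ℕ} : transposeGL (1 : GL (Fin n) 𝕜) = 1 :=
  Units.ext Matrix.transpose_one

/-- The group of lower triangular matrices with all diagonal entries equal to one, that is,
the group of transposes of upper triangular ones. -/
def lowerUnitGL (𝕜 : Type*) [RCLike 𝕜] (n : ℕ) : Subgroup (GL (Fin n) 𝕜) where
  carrier := {g | transposeGL g ∈ upperUnitGL 𝕜 n}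
  one_mem' := by
    rw [Set.mem_ofPred_eq, transposeGL_one]
    exact one_mem _
  mul_mem' := by
    intro a b ha hb
    rw [Set.mem_ofPred_eq, transposeGL_mul]
    exact mul_mem hb ha
  inv_mem' := by
    intro a ha
    have h : transposeGL a⁻¹ = (transposeGL a)⁻¹ := Units.ext rfl
    rw [Set.mem_ofPred_eq, h]
    exact inv_mem ha

/-- Entrywise complex conjugation on the general linear group (the identity if `𝕜 = ℝ`). -/
def conjGL {n : ℕ} : GL (Fin n) 𝕜 →* GL (Fin n) 𝕜 :=
  Matrix.GeneralLinearGroup.map (starRingEnd 𝕜)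

/-- The homomorphism `(G₁, G₂) ↦ G₁ ⊗ G₂` into the general linear group of the Kronecker
product. -/
def kroneckerGL {m n : ℕ} :
    GL (Fin n) 𝕜 × GL (Fin m) 𝕜 →* GL (Fin n × Fin m) 𝕜 :=
  (Units.map
    ({ toFun := fun p => p.1 ⊗ₖ p.2
       map_one' := Matrix.one_kronecker_one
       map_mul' := fun p q => Matrix.mul_kronecker_mul p.1 q.1 p.2 q.2 } :
      Matrix (Fin n) (Fin n) 𝕜 × Matrix (Fin m) (Fin m) 𝕜 →*
        Matrix (Fin n × Fin m) (Fin n × Fin m) 𝕜)).comp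
    MulEquiv.prodUnits.symm.toMonoidHom

/-! ### The groups of pairs `(G₁, G₂)` over which one optimizes

Each of them stands for the group of Kronecker products `G₁ ⊗ G₂` of its elements, which is its
image under `kroneckerGL`. -/

/-- `{V̄ ⊗ U : U, V unitary}`. -/
def svdGroup (𝕜 : Type*) [RCLike 𝕜] (m n : ℕ) : Subgroup (GL (Fin n) 𝕜 × GL (Fin m) 𝕜) :=
  ((unitaryGL 𝕜 n).map conjGL).prod (unitaryGL 𝕜 m)

/-- `{Rᵀ ⊗ Q : Q unitary, R upper unit triangular}`. -/
def qrGroup (𝕜 : Type*) [RCLike 𝕜] (m n : ℕ) : Subgroup (GL (Fin n) 𝕜 × GL (Fin m) 𝕜) :=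
  (lowerUnitGL 𝕜 n).prod (unitaryGL 𝕜 m)

/-- `{Qᵀ ⊗ P : P, Q of determinant one}`. -/
def equivGroup (𝕜 : Type*) [RCLike 𝕜] (n : ℕ) : Subgroup (GL (Fin n) 𝕜 × GL (Fin n) 𝕜) :=
  (specialGL 𝕜 n).prod (specialGL 𝕜 n)

/-- `{I ⊗ L : L lower unit triangular}`, used for LU and Cholesky. -/
def luGroup (𝕜 : Type*) [RCLike 𝕜] (m n : ℕ) : Subgroup (GL (Fin n) 𝕜 × GL (Fin m) 𝕜) :=
  (⊥ : Subgroup (GL (Fin n) 𝕜)).prod (lowerUnitGL 𝕜 m)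

/-- `{Q̄ ⊗ Q : Q unitary}`. -/
def schurGroup (𝕜 : Type*) [RCLike 𝕜] (n : ℕ) : Subgroup (GL (Fin n) 𝕜 × GL (Fin n) 𝕜) :=
  (unitaryGL 𝕜 n).map (conjGL.prod (MonoidHom.id _))

/-! ### Group orbit optimization -/

/-- The action `G₂ M G₁ᵀ` of a pair `(G₁, G₂)` on a matrix `M`. -/
def act {m n : ℕ} (G : GL (Fin n) 𝕜 × GL (Fin m) 𝕜) (M : Matrix (Fin m) (Fin n) 𝕜) :
    Matrix (Fin m) (Fin n) 𝕜 :=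
  (G.2 : Matrix (Fin m) (Fin m) 𝕜) * M * (G.1 : Matrix (Fin n) (Fin n) 𝕜)ᵀ

/-- `G` attains the infimum of `φ (G₂ M G₁ᵀ)` over the group `H` of pairs `(G₁, G₂)`. -/
def IsMinimizer {m n : ℕ} (H : Subgroup (GL (Fin n) 𝕜 × GL (Fin m) 𝕜))
    (φ : Matrix (Fin m) (Fin n) 𝕜 → ℝ) (M : Matrix (Fin m) (Fin n) 𝕜)
    (G : GL (Fin n) 𝕜 × GL (Fin m) 𝕜) : Prop :=
  G ∈ H ∧ ∀ G' ∈ H, φ (act G M) ≤ φ (act G' M)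

/-- The entrywise cost `∑ f(|x i j|)`. -/
def cost {m n : ℕ} (f : ℝ → ℝ) (X : Matrix (Fin m) (Fin n) 𝕜) : ℝ :=
  ∑ i, ∑ j, f ‖X i j‖

/-- The entrywise cost `∑ f(|x i j|)` of the strictly lower triangular part of `X`. -/
def lowerCost {m n : ℕ} (f : ℝ → ℝ) (X : Matrix (Fin m) (Fin n) 𝕜) : ℝ :=
  ∑ i : Fin m, ∑ j : Fin n, f ‖if (j : ℕ) < (i : ℕ) then X i j else 0‖

end

end GOO

namespace GOO

noncomputable section

variable {𝕜 : Type*} [RCLike 𝕜]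

/-! ### Concave functions of sums -/

section Concave

variable {ι : Type*} [Fintype ι] {g : ℝ → ℝ}

/-! For parts 1–3 put g(x) = f(√x) − f(0). Up to a constant the cost is Σ g(|x_ij|²), where g is
strictly concave and g(0) = 0. Such a g is subadditive, so each column contributes at least g of its
squared norm, with equality only if the column has at most one nonzero entry (`sum_colSq_le_sqCost`,
`colSparse_of_sqCost_le`). It remains to bound Σ_j g(‖x_j‖²) from below on the orbit by the cost of
the diagonal matrix.

For the SVD, the squared column norms of A D B are those of D averaged by the doubly stochastic
matrix |b_kj|², and Jensen applies (`sum_colSq_diag_le`). For QR, a factor with unit diagonal can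
only enlarge the columns of D, and g is monotone (`colSq_diag_le`). For matrix equivalence,
Hadamard's inequality bounds the product of the column norms by the invariant |det|, and Jensen is
applied to x ↦ g(eˣ) (`mul_le_sum_colSq`).

A minimizer attains these bounds, so its columns are sparse; its rows are sparse by transposition
or, for QR, by orthogonality of the columns. Such a matrix is a row and column permutation of a
diagonal one, with moduli fixed by the column norms (`exists_perm_norm_eq`).

For parts 4–6 the masked cost is nonnegative and vanishes exactly on upper triangular matrices. Once
the orbit contains one, the minimizers are precisely the triangularizing elements
(`isMinimizer_lowerCost_iff`); what remains is the existence of a triangular form and the rigidity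
of the factors. -/

lemma concave_segment (hg : ConcaveOn ℝ (Set.Ici 0) g) (h0 : g 0 = 0) {a S : ℝ} (ha : 0 ≤ a)
    (haS : a ≤ S) (hS : 0 < S) : a / S * g S ≤ g a := by
  have h := hg.2 (Set.mem_Ici.2 hS.le) (Set.mem_Ici.2 le_rfl) (div_nonneg ha hS.le)
    (sub_nonneg.2 ((div_le_one hS).2 haS)) (by ring)
  simpa [h0, div_mul_cancel₀ _ hS.ne'] using h

lemma strictConcave_segment (hg : StrictConcaveOn ℝ (Set.Ici 0) g) (h0 : g 0 = 0) {a S : ℝ}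
    (ha : 0 < a) (haS : a < S) : a / S * g S < g a := by
  have hS : 0 < S := ha.trans haS
  have h := hg.2 (Set.mem_Ici.2 hS.le) (Set.mem_Ici.2 le_rfl) hS.ne' (div_pos ha hS)
    (sub_pos.2 ((div_lt_one hS).2 haS)) (by ring)
  simpa [h0, div_mul_cancel₀ _ hS.ne'] using h

/-- A concave function vanishing at zero is subadditive on nonnegative reals. -/
lemma concave_sum_le (hg : ConcaveOn ℝ (Set.Ici 0) g) (h0 : g 0 = 0) (a : ι → ℝ)
    (ha : ∀ i, 0 ≤ a i) : g (∑ i, a i) ≤ ∑ i, g (a i) := by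
  rcases (Finset.sum_nonneg fun i _ => ha i).eq_or_lt with hS | hS
  · have : ∀ i, a i = 0 := fun i =>
      (Finset.sum_eq_zero_iff_of_nonneg fun i _ => ha i).1 hS.symm i (Finset.mem_univ i)
    simp [this, h0]
  -- With S the total, g lies above the chord from 0 to S at each a i; the weights a i / S add up to
  -- one.
  · calc g (∑ i, a i) = ∑ i, a i / (∑ i, a i) * g (∑ i, a i) := by
          rw [← Finset.sum_mul, ← Finset.sum_div, div_self hS.ne', one_mul]
      _ ≤ ∑ i, g (a i) := Finset.sum_le_sum fun i _ => concave_segment hg h0 (ha i)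
          (Finset.single_le_sum (fun i _ => ha i) (Finset.mem_univ i)) hS

/-- If two terms were positive, each would lie strictly between 0 and the total, where the chord
inequality is strict. -/
lemma at_most_one_of_sum_le (hg : StrictConcaveOn ℝ (Set.Ici 0) g) (h0 : g 0 = 0) (a : ι → ℝ)
    (ha : ∀ i, 0 ≤ a i) (h : ∑ i, g (a i) ≤ g (∑ i, a i)) {i j : ι} (hij : i ≠ j) :
    a i = 0 ∨ a j = 0 := by
  classical
  by_contra! hne
  have hi : 0 < a i := (ha i).lt_of_ne' hne.1
  have hj : 0 < a j := (ha j).lt_of_ne' hne.2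
  have hlt : a i < ∑ i, a i := by
    have := Finset.sum_le_sum_of_subset_of_nonneg (Finset.subset_univ {i, j})
      (fun k _ _ => ha k)
    rw [Finset.sum_pair hij] at this
    linarith
  have hS : 0 < ∑ i, a i := hi.trans hlt
  refine h.not_gt ?_
  calc g (∑ i, a i) = ∑ i, a i / (∑ i, a i) * g (∑ i, a i) := by
        rw [← Finset.sum_mul, ← Finset.sum_div, div_self hS.ne', one_mul]
    _ < ∑ i, g (a i) := Finset.sum_lt_sum
        (fun i _ => concave_segment hg.concaveOn h0 (ha i)
          (Finset.single_le_sum (fun i _ => ha i) (Finset.mem_univ i)) hS)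
        ⟨i, Finset.mem_univ i, strictConcave_segment hg h0 hi hlt⟩

lemma sum_eq_of_at_most_one (h0 : g 0 = 0) (a : ι → ℝ)
    (h : ∀ i j, i ≠ j → a i = 0 ∨ a j = 0) : ∑ i, g (a i) = g (∑ i, a i) := by
  by_cases hz : ∀ i, a i = 0
  · simp [hz, h0]
  · push Not at hz
    obtain ⟨i, hi⟩ := hz
    have hj : ∀ j, j ≠ i → a j = 0 := fun j hji => (h j i hji).resolve_right hi
    rw [Finset.sum_eq_single i (fun j _ hji => by rw [hj j hji, h0]) (by simp),
      Finset.sum_eq_single i (fun j _ hji => hj j hji) (by simp)]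

end Concave

/-! ### Column norms and costs -/

section Columns

variable {m n p : Type*} [Fintype m] [Fintype p]

/-- The squared Euclidean norm of a column. -/
def colSq (X : Matrix m n 𝕜) (j : n) : ℝ := ∑ i, ‖X i j‖ ^ 2

/-- Every column has at most one nonzero entry. -/
def ColSparse (X : Matrix m n 𝕜) : Prop := ∀ j i i', i ≠ i' → X i j = 0 ∨ X i' j = 0

/-- The sum of the values of `g` at the squared absolute values of the entries. -/
def sqCost [Fintype n] (g : ℝ → ℝ) (X : Matrix m n 𝕜) : ℝ := ∑ j, ∑ i, g (‖X i j‖ ^ 2)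

lemma colSq_nonneg (X : Matrix m n 𝕜) (j : n) : 0 ≤ colSq X j :=
  Finset.sum_nonneg fun _ _ => sq_nonneg _

lemma conjTranspose_mul_self_apply (X : Matrix m n 𝕜) (j : n) :
    (Xᴴ * X) j j = (colSq X j : 𝕜) := by
  simp only [colSq, mul_apply, conjTranspose_apply, RCLike.star_def, RCLike.conj_mul]
  push_cast
  rfl

/-- Squared column norms are the diagonal entries of the Gram matrix. -/
lemma colSq_eq_of_gram_eq {X : Matrix m n 𝕜} {Y : Matrix p n 𝕜} (h : Xᴴ * X = Yᴴ * Y) (j : n) :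
    colSq X j = colSq Y j := by
  have := conjTranspose_mul_self_apply X j
  rw [h, conjTranspose_mul_self_apply] at this
  exact_mod_cast this.symm

lemma colSq_eq_zero {X : Matrix m n 𝕜} {j : n} : colSq X j = 0 ↔ ∀ i, X i j = 0 := by
  rw [colSq, Finset.sum_eq_zero_iff_of_nonneg fun _ _ => sq_nonneg _]
  simp

lemma ColSparse.colSq_eq {X : Matrix m n 𝕜} (hX : ColSparse X) {i : m} {j : n} (h : X i j ≠ 0) :
    colSq X j = ‖X i j‖ ^ 2 :=
  Finset.sum_eq_single i
    (fun k _ hk => by rw [(hX j k i hk).resolve_right h, norm_zero, zero_pow two_ne_zero])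
    (by simp)

lemma sqCost_transpose [Fintype n] (g : ℝ → ℝ) (X : Matrix m n 𝕜) : sqCost g Xᵀ = sqCost g X :=
  Finset.sum_comm

variable [Fintype n] {g : ℝ → ℝ}

lemma sum_colSq_le_sqCost (hg : ConcaveOn ℝ (Set.Ici 0) g) (h0 : g 0 = 0) (X : Matrix m n 𝕜) :
    ∑ j, g (colSq X j) ≤ sqCost g X :=
  Finset.sum_le_sum fun j _ => concave_sum_le hg h0 _ fun i => sq_nonneg ‖X i j‖

/-- Equality of the two sums forces equality in every column, and strict concavity then leaves at
most one nonzero entry there. -/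
lemma colSparse_of_sqCost_le (hg : StrictConcaveOn ℝ (Set.Ici 0) g) (h0 : g 0 = 0)
    {X : Matrix m n 𝕜} (h : sqCost g X ≤ ∑ j, g (colSq X j)) : ColSparse X := by
  intro j i i' hii
  have hle : ∀ j ∈ Finset.univ, g (colSq X j) ≤ ∑ i, g (‖X i j‖ ^ 2) := fun j _ =>
    concave_sum_le hg.concaveOn h0 _ fun i => sq_nonneg ‖X i j‖
  have heq := (Finset.sum_eq_sum_iff_of_le hle).1
    (le_antisymm (Finset.sum_le_sum hle) h) j (Finset.mem_univ j)
  simpa using at_most_one_of_sum_le hg h0 (fun i => ‖X i j‖ ^ 2) (fun i => sq_nonneg _)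
    heq.ge hii

lemma ColSparse.sqCost_eq (h0 : g 0 = 0) {X : Matrix m n 𝕜} (hX : ColSparse X) :
    sqCost g X = ∑ j, g (colSq X j) :=
  Finset.sum_congr rfl fun j _ => sum_eq_of_at_most_one h0 (fun i => ‖X i j‖ ^ 2)
    fun i i' h => by simpa using hX j i i' h

end Columns

section FinMatrices

variable {m n : ℕ}

/-- Splitting off a constant normalizes the function to vanish at zero, which subadditivity
requires. -/
lemma cost_eq_sqCost (f : ℝ → ℝ) (X : Matrix (Fin m) (Fin n) 𝕜) :
    cost f X = sqCost (fun x => f (√x) - f 0) X + m * n * f 0 := by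
  simp only [cost, sqCost, Real.sqrt_sq (norm_nonneg _), Finset.sum_sub_distrib]
  rw [Finset.sum_comm]
  simp
  ring

lemma IsRectDiag.colSparse {D : Matrix (Fin m) (Fin n) 𝕜} (hD : IsRectDiag D) : ColSparse D := by
  intro j i i' h
  by_cases hi : (i : ℕ) = j
  · exact Or.inr (hD i' j fun e => h (Fin.ext (hi.trans e.symm)))
  · exact Or.inl (hD i j hi)

lemma IsRectDiag.transpose {D : Matrix (Fin m) (Fin n) 𝕜} (hD : IsRectDiag D) : IsRectDiag Dᵀ :=
  fun i j h => hD j i h.symm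

/-- When rows have at most one nonzero entry, distinct columns have disjoint supports and are
orthogonal. -/
lemma gram_eq_diagonal {X : Matrix (Fin m) (Fin n) 𝕜} (hX : ColSparse Xᵀ) :
    Xᴴ * X = diagonal fun j => (colSq X j : 𝕜) := by
  ext j k
  rcases eq_or_ne j k with rfl | hjk
  · rw [diagonal_apply_eq, conjTranspose_mul_self_apply]
  · rw [diagonal_apply_ne _ hjk, mul_apply]
    refine Finset.sum_eq_zero fun i _ => ?_
    rcases hX i j k hjk with h | h <;> rw [transpose_apply] at h <;> simp [h]

/-- A matrix with at most one nonzero entry in each row and column has, up to permutations of rows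
and columns, the absolute values of a diagonal matrix whose columns have the same norms. -/
lemma exists_perm_norm_eq {X D : Matrix (Fin m) (Fin n) 𝕜} (hX : ColSparse X)
    (hX' : ColSparse Xᵀ) (hD : IsRectDiag D) (τ : Equiv.Perm (Fin n))
    (hτ : ∀ j, colSq X (τ j) = colSq D j) :
    ∃ σ : Equiv.Perm (Fin m), ∀ i j, ‖X (σ i) (τ j)‖ = ‖D i j‖ := by
  -- The row `r` is where column `τ j` of `X` is supported, if `D i j ≠ 0`; for a zero row of `D`
  -- the choice is immaterial.
  have key : ∀ i : Fin m, ∃ r : Fin m, ∀ j : Fin n, D i j ≠ 0 → X r (τ j) ≠ 0 := by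
    intro i
    by_cases h : ∃ j, D i j ≠ 0
    · obtain ⟨j, hj⟩ := h
      have h1 : colSq X (τ j) ≠ 0 := by
        rw [hτ, Ne, colSq_eq_zero]
        exact fun h => hj (h i)
      rw [Ne, colSq_eq_zero] at h1
      push Not at h1
      obtain ⟨r, hr⟩ := h1
      refine ⟨r, fun k hk => ?_⟩
      have e1 : (i : ℕ) = j := by_contra fun h => hj (hD i j h)
      have e2 : (i : ℕ) = k := by_contra fun h => hk (hD i k h)
      rwa [← Fin.ext (e1.symm.trans e2)]
    · push Not at h
      exact ⟨i, fun j hj => absurd (h j) hj⟩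
  choose r hr using key
  have hinj : Set.InjOn r {i | ∃ j, D i j ≠ 0} := by
    rintro i ⟨j, hj⟩ i' ⟨j', hj'⟩ h
    have h1 := hr i j hj
    have h2 := hr i' j' hj'
    rw [← h] at h2
    have : τ j = τ j' := by
      by_contra hne
      rcases hX' (r i) _ _ hne with h | h
      exacts [h1 h, h2 h]
    have := τ.injective this
    subst this
    by_contra hne
    rcases hD.colSparse j _ _ hne with h | h
    exacts [hj h, hj' h]
  -- The partial injection on the nonzero rows of `D` extends to a bijection of all rows.
  obtain ⟨e, he⟩ := Set.MapsTo.exists_equiv_extend_of_card_eq (t := Finset.univ) (by simp)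
    (fun i _ => by simp) hinj
  refine ⟨e.trans (Equiv.subtypeUnivEquiv Finset.mem_univ), fun i j => ?_⟩
  change ‖X (e i) (τ j)‖ = _
  by_cases hc : colSq D j = 0
  · have h1 := colSq_eq_zero.1 ((hτ j).trans hc)
    rw [h1, colSq_eq_zero.1 hc]
  · obtain ⟨i₀, hi₀⟩ := not_forall.1 (mt colSq_eq_zero.2 hc)
    have h1 : X (e i₀) (τ j) ≠ 0 := by
      rw [he i₀ ⟨j, hi₀⟩]
      exact hr i₀ j hi₀
    by_cases hi : i = i₀
    · subst hi
      have h2 := hτ j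
      rw [hX.colSq_eq h1, hD.colSparse.colSq_eq hi₀] at h2
      exact (sq_eq_sq₀ (norm_nonneg _) (norm_nonneg _)).1 h2
    · rw [(hX _ _ _ fun h => hi (e.injective (Subtype.ext h))).resolve_right h1,
        (hD.colSparse _ _ _ hi).resolve_right hi₀]

/-- This turns a reindexing of rows and columns into the permutation factors of a decomposition. -/
lemma permMatrix_mul_mul_permMatrix (Z : Matrix (Fin m) (Fin n) 𝕜) (σ : Equiv.Perm (Fin m))
    (τ : Equiv.Perm (Fin n)) :
    σ⁻¹.permMatrix 𝕜 * Z.submatrix σ τ * (τ⁻¹.permMatrix 𝕜)ᴴ = Z := by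
  rw [conjTranspose_permMatrix, inv_inv, Equiv.Perm.permMatrix, Equiv.Perm.permMatrix,
    PEquiv.toMatrix_toPEquiv_mul, PEquiv.mul_toMatrix_toPEquiv]
  ext i j
  simp

/-- The roots, as a multiset, are the diagonal entries. Equal multisets have fibers of equal size
over each value, and bijections between the fibers glue to a permutation. -/
lemma exists_perm_of_charpoly_eq {a b : Fin n → 𝕜}
    (h : (diagonal a).charpoly = (diagonal b).charpoly) :
    ∃ τ : Equiv.Perm (Fin n), ∀ j, a (τ j) = b j := by
  classical
  rw [charpoly_diagonal, charpoly_diagonal] at h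
  have hr := congrArg Polynomial.roots h
  have hroots : ∀ c : Fin n → 𝕜, (∏ i, (Polynomial.X - Polynomial.C (c i))).roots =
      Finset.univ.val.map c := fun c => by
    rw [← Polynomial.roots_multiset_prod_X_sub_C (Finset.univ.val.map c), Multiset.map_map]
    rfl
  rw [hroots, hroots] at hr
  have hcard : ∀ c, Nonempty ({j // b j = c} ≃ {j // a j = c}) := fun c => by
    refine Fintype.card_eq.1 ?_
    have := congrArg (Multiset.count c) hr
    rw [Multiset.count_map, Multiset.count_map] at this
    rw [Fintype.card_subtype, Fintype.card_subtype, Finset.card_def, Finset.card_def,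
      Finset.filter_val, Finset.filter_val]
    simpa only [eq_comm] using this.symm
  exact ⟨Equiv.ofFiberEquiv fun c => (hcard c).some, fun j => Equiv.ofFiberEquiv_map _ j⟩

end FinMatrices

/-! ### Membership in the matrix groups -/

section Groups

variable {n : ℕ}

lemma mem_unitaryGL {g : GL (Fin n) 𝕜} :
    g ∈ unitaryGL 𝕜 n ↔ (g : Matrix (Fin n) (Fin n) 𝕜) ∈ unitaryGroup (Fin n) 𝕜 := by
  refine ⟨fun h => h.1, fun h => ⟨h, ?_⟩⟩
  have : ((g⁻¹ : GL (Fin n) 𝕜) : Matrix (Fin n) (Fin n) 𝕜) =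
      star (g : Matrix (Fin n) (Fin n) 𝕜) :=
    Units.inv_eq_of_mul_eq_one_right (mem_unitaryGroup_iff.1 h)
  change ((g⁻¹ : GL (Fin n) 𝕜) : Matrix (Fin n) (Fin n) 𝕜) ∈ unitaryGroup (Fin n) 𝕜
  rw [this]
  exact Unitary.star_mem h

lemma coe_inv_of_mem_unitaryGL {g : GL (Fin n) 𝕜} (hg : g ∈ unitaryGL 𝕜 n) :
    ((g⁻¹ : GL (Fin n) 𝕜) : Matrix (Fin n) (Fin n) 𝕜) = (g : Matrix (Fin n) (Fin n) 𝕜)ᴴ :=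
  Units.inv_eq_of_mul_eq_one_right (mem_unitaryGroup_iff.1 (mem_unitaryGL.1 hg))

lemma exists_unitaryGL {U : Matrix (Fin n) (Fin n) 𝕜} (hU : U ∈ unitaryGroup (Fin n) 𝕜) :
    ∃ g ∈ unitaryGL 𝕜 n, (g : Matrix (Fin n) (Fin n) 𝕜) = U :=
  ⟨⟨U, star U, mem_unitaryGroup_iff.1 hU, mem_unitaryGroup_iff'.1 hU⟩, mem_unitaryGL.2 hU, rfl⟩

lemma det_upper_unit {R : Matrix (Fin n) (Fin n) 𝕜} (hR : IsUpperTri R) (h1 : ∀ i, R i i = 1) :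
    R.det = 1 := by
  rw [det_of_isUpperTriangular fun i j h => hR i j h]
  simp [h1]

lemma exists_upperUnitGL {R : Matrix (Fin n) (Fin n) 𝕜} (hR : IsUpperTri R)
    (h1 : ∀ i, R i i = 1) : ∃ g ∈ upperUnitGL 𝕜 n, (g : Matrix (Fin n) (Fin n) 𝕜) = R :=
  ⟨GeneralLinearGroup.mkOfDetNeZero R (by rw [det_upper_unit hR h1]; exact one_ne_zero),
    ⟨hR, h1⟩, rfl⟩

lemma mem_specialGL {g : GL (Fin n) 𝕜} :
    g ∈ specialGL 𝕜 n ↔ (g : Matrix (Fin n) (Fin n) 𝕜).det = 1 := by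
  rw [specialGL, MonoidHom.mem_ker, Units.ext_iff]
  rfl

lemma exists_specialGL {P : Matrix (Fin n) (Fin n) 𝕜} (hP : P.det = 1) :
    ∃ g ∈ specialGL 𝕜 n, (g : Matrix (Fin n) (Fin n) 𝕜) = P :=
  ⟨GeneralLinearGroup.mkOfDetNeZero P (by rw [hP]; exact one_ne_zero), mem_specialGL.2 hP, rfl⟩

lemma transposeGL_transposeGL (g : GL (Fin n) 𝕜) : transposeGL (transposeGL g) = g :=
  Units.ext (transpose_transpose _)

lemma transposeGL_mem_lowerUnitGL {g : GL (Fin n) 𝕜} :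
    transposeGL g ∈ lowerUnitGL 𝕜 n ↔ g ∈ upperUnitGL 𝕜 n := by
  change transposeGL (transposeGL g) ∈ upperUnitGL 𝕜 n ↔ _
  rw [transposeGL_transposeGL]

lemma norm_det_unitary {U : Matrix (Fin n) (Fin n) 𝕜} (hU : U ∈ unitaryGroup (Fin n) 𝕜) :
    ‖U.det‖ = 1 := by
  have h : U.det * star U.det = 1 := by
    rw [← det_conjTranspose, ← det_mul]
    exact (congrArg det (mem_unitaryGroup_iff.1 hU)).trans det_one
  have h2 := congrArg norm h
  rw [norm_mul, norm_star, norm_one] at h2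
  nlinarith [norm_nonneg U.det]

lemma conjTranspose_mem_unitaryGroup {U : Matrix (Fin n) (Fin n) 𝕜}
    (hU : U ∈ unitaryGroup (Fin n) 𝕜) : Uᴴ ∈ unitaryGroup (Fin n) 𝕜 :=
  Unitary.star_mem hU

lemma transpose_mem_unitaryGroup {U : Matrix (Fin n) (Fin n) 𝕜}
    (hU : U ∈ unitaryGroup (Fin n) 𝕜) : Uᵀ ∈ unitaryGroup (Fin n) 𝕜 := by
  rw [mem_unitaryGroup_iff, star_eq_conjTranspose, show Uᵀᴴ = Uᴴᵀ from rfl,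
    ← transpose_mul]
  exact (congrArg transpose (mem_unitaryGroup_iff'.1 hU)).trans transpose_one

end Groups

/-! ### Existence of the decompositions -/

section Existence

variable {m n : ℕ}

lemma inner_toLp (x y : Fin m → 𝕜) :
    inner 𝕜 (WithLp.toLp 2 x) (WithLp.toLp 2 y) = ∑ i, star (x i) * y i := by
  rw [EuclideanSpace.inner_eq_star_dotProduct, dotProduct]
  exact Finset.sum_congr rfl fun i _ => mul_comm _ _

lemma norm_toLp_col (Y : Matrix (Fin m) (Fin n) 𝕜) (j : Fin n) :
    ‖WithLp.toLp 2 (Y.col j)‖ = √(colSq Y j) := by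
  rw [EuclideanSpace.norm_eq]
  rfl

/-- The matrix whose columns are an orthonormal basis. -/
lemma of_orthonormalBasis_mem_unitaryGroup
    (b : OrthonormalBasis (Fin m) 𝕜 (EuclideanSpace 𝕜 (Fin m))) :
    (of fun i j => b j i : Matrix (Fin m) (Fin m) 𝕜) ∈ unitaryGroup (Fin m) 𝕜 := by
  rw [mem_unitaryGroup_iff']
  ext j k
  have := orthonormal_iff_ite.1 b.orthonormal j k
  rw [one_apply, ← this]
  exact (inner_toLp _ _).symm

/-- Normalize the nonzero columns and extend them to an orthonormal basis. This is the common last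
step of the SVD and of the QR decomposition. -/
lemma exists_unitary_of_orthogonal_columns (hnm : n ≤ m) (Y : Matrix (Fin m) (Fin n) 𝕜)
    (hY : ∀ j k, j ≠ k → (Yᴴ * Y) j k = 0) :
    ∃ U ∈ unitaryGroup (Fin m) 𝕜, ∃ S : Matrix (Fin m) (Fin n) ℝ,
      IsRectDiag S ∧ (∀ i j, 0 ≤ S i j) ∧ Y = U * S.map (fun x : ℝ => (x : 𝕜)) := by
  -- The columns are padded with zero vectors to a family of length `m`, so that the basis extending
  -- the normalized ones is indexed by the rows.
  let w : Fin m → EuclideanSpace 𝕜 (Fin m) := fun i =>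
    if h : (i : ℕ) < n then WithLp.toLp 2 (Y.col ⟨i, h⟩) else 0
  let v : Fin m → EuclideanSpace 𝕜 (Fin m) := fun i => ((‖w i‖⁻¹ : ℝ) : 𝕜) • w i
  have hw : ∀ i k, i ≠ k → inner 𝕜 (w i) (w k) = 0 := by
    intro i k hik
    by_cases hi : (i : ℕ) < n
    · by_cases hk : (k : ℕ) < n
      · simp only [w, dif_pos hi, dif_pos hk]
        rw [inner_toLp]
        exact hY ⟨i, hi⟩ ⟨k, hk⟩ fun h => hik (Fin.ext (Fin.mk.inj h))
      · simp [w, dif_neg hk]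
    · simp [w, dif_neg hi]
  have hv : Orthonormal 𝕜 (Set.domRestrict {i | w i ≠ 0} v) := by
    constructor
    · rintro ⟨i, hi⟩
      have : ‖w i‖ ≠ 0 := norm_ne_zero_iff.2 hi
      simp [v, norm_smul, this]
    · rintro ⟨i, hi⟩ ⟨k, hk⟩ hik
      have hik' : i ≠ k := fun h => hik (Subtype.ext h)
      simp [v, inner_smul_left, inner_smul_right, hw i k hik']
  obtain ⟨b, hb⟩ := hv.exists_orthonormalBasis_extension_of_card_eq (by simp)
  refine ⟨_, of_orthonormalBasis_mem_unitaryGroup b,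
    of fun i j => if (i : ℕ) = j then √(colSq Y j) else 0, fun i j h => if_neg h, fun i j => ?_, ?_⟩
  · rw [of_apply]
    split_ifs
    exacts [Real.sqrt_nonneg _, le_rfl]
  · ext i j
    rw [mul_apply, Finset.sum_eq_single (Fin.castLE hnm j)]
    · have hwj : w (Fin.castLE hnm j) = WithLp.toLp 2 (Y.col j) := by simp [w]
      simp only [of_apply, map_apply, Fin.val_castLE, if_true]
      -- At a zero column the basis vector is arbitrary, but its coefficient is zero.
      by_cases h0 : w (Fin.castLE hnm j) = 0
      · have h1 : ‖w (Fin.castLE hnm j)‖ = 0 := norm_eq_zero.2 h0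
        have h2 := h0
        rw [hwj, norm_toLp_col] at h1
        rw [hwj] at h2
        rw [h1, RCLike.ofReal_zero, mul_zero]
        exact congrArg (fun x : EuclideanSpace 𝕜 (Fin m) => x i) h2
      · have hn : ((‖w (Fin.castLE hnm j)‖ : ℝ) : 𝕜) ≠ 0 := by
          exact_mod_cast norm_ne_zero_iff.2 h0
        rw [hb _ h0, ← norm_toLp_col, ← hwj]
        simp only [v, PiLp.smul_apply, smul_eq_mul, RCLike.ofReal_inv]
        rw [mul_comm, mul_inv_cancel_left₀ hn, hwj]
        rfl
    · intro k _ hk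
      have hk' : (k : ℕ) ≠ j := fun h => hk (Fin.ext h)
      simp only [of_apply, map_apply]
      rw [if_neg hk', RCLike.ofReal_zero, mul_zero]
    · simp

/-- If `V` consists of eigenvectors of `Mᴴ * M`, the columns of `M * V` are orthogonal. -/
lemma exists_svd_of_le (hnm : n ≤ m) (M : Matrix (Fin m) (Fin n) 𝕜) :
    ∃ U ∈ unitaryGroup (Fin m) 𝕜, ∃ V ∈ unitaryGroup (Fin n) 𝕜, ∃ S : Matrix (Fin m) (Fin n) ℝ,
      IsRectDiag S ∧ (∀ i j, 0 ≤ S i j) ∧ M = U * S.map (fun x : ℝ => (x : 𝕜)) * Vᴴ := by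
  have hA := isHermitian_conjTranspose_mul_self M
  have hV := hA.eigenvectorUnitary.2
  have hVV := mem_unitaryGroup_iff.1 hV
  have hVV' := mem_unitaryGroup_iff'.1 hV
  have hsp := hA.spectral_theorem
  rw [Unitary.conjStarAlgAut_apply] at hsp
  set V : Matrix (Fin n) (Fin n) 𝕜 := (hA.eigenvectorUnitary : Matrix (Fin n) (Fin n) 𝕜)
  rw [star_eq_conjTranspose] at hVV hVV' hsp
  have hgram : (M * V)ᴴ * (M * V) = diagonal (RCLike.ofReal ∘ hA.eigenvalues) := by
    have h : (M * V)ᴴ * (M * V) = Vᴴ * (Mᴴ * M) * V := by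
      simp only [conjTranspose_mul, Matrix.mul_assoc]
    refine h.trans ((congrArg (fun A => Vᴴ * A * V) hsp).trans ?_)
    simp only [Matrix.mul_assoc, hVV', Matrix.mul_one]
    rw [← Matrix.mul_assoc, hVV', Matrix.one_mul]
  obtain ⟨U, hU, S, hS, hS0, h⟩ := exists_unitary_of_orthogonal_columns hnm (M * V)
    fun j k hjk => by rw [hgram, diagonal_apply_ne _ hjk]
  refine ⟨U, hU, V, hV, S, hS, hS0, ?_⟩
  rw [← h, Matrix.mul_assoc, hVV, Matrix.mul_one]

/-- Every matrix has a singular value decomposition. -/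
theorem exists_svd (M : Matrix (Fin m) (Fin n) 𝕜) :
    ∃ U ∈ unitaryGroup (Fin m) 𝕜, ∃ V ∈ unitaryGroup (Fin n) 𝕜, ∃ S : Matrix (Fin m) (Fin n) ℝ,
      IsRectDiag S ∧ (∀ i j, 0 ≤ S i j) ∧ M = U * S.map (fun x : ℝ => (x : 𝕜)) * Vᴴ := by
  rcases le_total n m with h | h
  · exact exists_svd_of_le h M
  · obtain ⟨U, hU, V, hV, S, hS, hS0, hM⟩ := exists_svd_of_le h Mᴴ
    refine ⟨V, hV, U, hU, Sᵀ, hS.transpose, fun i j => hS0 j i, ?_⟩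
    rw [← conjTranspose_conjTranspose M, hM, conjTranspose_mul, conjTranspose_mul,
      conjTranspose_conjTranspose, Matrix.mul_assoc]
    congr 2
    ext i j
    simp

/-- Every matrix with at least as many rows as columns is a product of a unitary, a diagonal and
an upper triangular matrix with unit diagonal. -/
theorem exists_qdr (hnm : n ≤ m) (M : Matrix (Fin m) (Fin n) 𝕜) :
    ∃ Q ∈ unitaryGroup (Fin m) 𝕜, ∃ D : Matrix (Fin m) (Fin n) 𝕜, ∃ R : Matrix (Fin n) (Fin n) 𝕜,
      IsRectDiag D ∧ IsUpperTri R ∧ (∀ i, R i i = 1) ∧ M = Q * D * R := by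
  let f : Fin n → EuclideanSpace 𝕜 (Fin m) := fun j => WithLp.toLp 2 (M.col j)
  let y := InnerProductSpace.gramSchmidt 𝕜 f
  let Y : Matrix (Fin m) (Fin n) 𝕜 := of fun i j => y j i
  -- The coefficients of Gram–Schmidt without normalization, whence the unit diagonal. If `y i = 0`,
  -- division by zero gives the coefficient 0.
  let R : Matrix (Fin n) (Fin n) 𝕜 := of fun i j =>
    if i = j then 1 else if i < j then inner 𝕜 (y i) (f j) / (‖y i‖ : 𝕜) ^ 2 else 0
  have hM : M = Y * R := by
    ext i j
    have h := congrArg (fun x : EuclideanSpace 𝕜 (Fin m) => x i)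
      (InnerProductSpace.gramSchmidt_def'' 𝕜 f j)
    simp only [PiLp.add_apply, WithLp.ofLp_sum, Finset.sum_apply, PiLp.smul_apply,
      smul_eq_mul] at h
    rw [mul_apply, ← Finset.add_sum_erase _ _ (Finset.mem_univ j)]
    have hsub : ∑ k ∈ Finset.univ.erase j, Y i k * R k j = ∑ k ∈ Finset.Iio j, Y i k * R k j := by
      refine (Finset.sum_subset (fun k hk => ?_) fun k hk hk' => ?_).symm
      · exact Finset.mem_erase.2 ⟨(Finset.mem_Iio.1 hk).ne, Finset.mem_univ k⟩
      · simp only [R, of_apply]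
        rw [if_neg (Finset.ne_of_mem_erase hk), if_neg (mt Finset.mem_Iio.2 hk'), mul_zero]
    rw [hsub]
    refine h.trans (congrArg₂ _ (by simp [R, Y, y]) (Finset.sum_congr rfl fun k hk => ?_))
    have hk := Finset.mem_Iio.1 hk
    simp only [R, Y, y, of_apply]
    rw [if_neg hk.ne, if_pos hk, mul_comm]
  obtain ⟨Q, hQ, S, hS, -, hY⟩ := exists_unitary_of_orthogonal_columns hnm Y fun j k hjk => by
    rw [← InnerProductSpace.gramSchmidt_orthogonal 𝕜 f hjk]
    exact (inner_toLp _ _).symm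
  refine ⟨Q, hQ, _, R, fun i j h => ?_, fun i j h => ?_, fun i => ?_, by rw [← hY]; exact hM⟩
  · rw [map_apply, hS i j h, RCLike.ofReal_zero]
  · simp only [R, of_apply]
    rw [if_neg fun e => by subst e; exact lt_irrefl _ h, if_neg (lt_asymm (a := j) (b := i) h)]
  · simp [R]

/-- Induction on the dimension: split off a unit eigenvector `v` and treat the compression of `T` to
its orthogonal complement. The complement need not be invariant, as only inner products with its own
vectors are tested. -/
lemma exists_triangularizing_basis {E : Type*} [NormedAddCommGroup E] [InnerProductSpace ℂ E]
    [FiniteDimensional ℂ E] (n : ℕ) (hn : Module.finrank ℂ E = n) (T : E →ₗ[ℂ] E) :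
    ∃ b : Fin n → E, Orthonormal ℂ b ∧ ∀ i j, j < i → inner ℂ (b i) (T (b j)) = 0 := by
  induction n generalizing E with
  | zero => exact ⟨finZeroElim, ⟨finZeroElim, fun i => i.elim0⟩, fun i => i.elim0⟩
  | succ n ih =>
    have : Nontrivial E := Module.nontrivial_of_finrank_pos (R := ℂ) (by omega)
    obtain ⟨μ, hμ⟩ := Module.End.exists_eigenvalue T
    obtain ⟨u, hu⟩ := hμ.exists_hasEigenvector
    let v : E := ((‖u‖⁻¹ : ℝ) : ℂ) • u
    have hv1 : ‖v‖ = 1 := by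
      have : ‖u‖ ≠ 0 := norm_ne_zero_iff.2 hu.2
      simp [v, norm_smul, this]
    have hv0 : v ≠ 0 := fun h => by simp [h] at hv1
    have hTv : T v = μ • v := by
      simp only [v, map_smul]
      rw [hu.apply_eq_smul, smul_comm]
    let W : Submodule ℂ E := (ℂ ∙ v)ᗮ
    have : Fact (Module.finrank ℂ E = n + 1) := ⟨hn⟩
    obtain ⟨b, hb, hbT⟩ := ih (E := W) (Submodule.finrank_orthogonal_span_singleton hv0)
      (W.orthogonalProjectionOnto.toLinearMap ∘ₗ T ∘ₗ W.subtype)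
    have hvb : ∀ i, inner ℂ v (b i : E) = 0 := fun i =>
      Submodule.mem_orthogonal_singleton_iff_inner_right.1 (b i).2
    have hbv : ∀ i, inner ℂ (b i : E) v = 0 := fun i =>
      Submodule.mem_orthogonal_singleton_iff_inner_left.1 (b i).2
    refine ⟨Fin.cons v fun i => (b i : E), ⟨?_, ?_⟩, ?_⟩
    · exact Fin.cases hv1 fun i => hb.1 i
    · intro i j
      induction i using Fin.cases with
      | zero =>
        induction j using Fin.cases with
        | zero => exact fun h => absurd rfl h
        | succ j => exact fun _ => hvb j
      | succ i =>
        induction j using Fin.cases with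
        | zero => exact fun _ => hbv i
        | succ j => exact fun h => hb.2 fun e => h (congrArg _ e)
    · intro i j
      induction i using Fin.cases with
      | zero => exact fun h => absurd h (Fin.not_lt_zero j)
      | succ i =>
        induction j using Fin.cases with
        | zero =>
          intro _
          simp [hTv, hbv]
        | succ j =>
          intro h
          have := hbT i j (Fin.succ_lt_succ_iff.1 h)
          rw [LinearMap.comp_apply] at this
          erw [Submodule.inner_orthogonalProjectionOnto_eq_of_mem_left] at this
          exact this

/-- Every complex square matrix is unitarily similar to an upper triangular matrix. -/
theorem exists_schur (M : Matrix (Fin n) (Fin n) ℂ) :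
    ∃ Q ∈ unitaryGroup (Fin n) ℂ, IsUpperTri (Qᴴ * M * Q) := by
  obtain ⟨b, hb, hT⟩ := exists_triangularizing_basis n (by simp) (toEuclideanLin M)
  refine ⟨of fun i j => b j i, ?_, fun i j h => ?_⟩
  · rw [mem_unitaryGroup_iff']
    ext j k
    rw [one_apply, ← orthonormal_iff_ite.1 hb j k]
    exact (inner_toLp _ _).symm
  · rw [Matrix.mul_assoc, ← hT i j h]
    exact (inner_toLp _ _).symm

/-- Every positive definite matrix is a Gram matrix. -/
lemma exists_eq_conjTranspose_mul_self {M : Matrix (Fin n) (Fin n) 𝕜} (hM : M.PosDef) :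
    ∃ B : Matrix (Fin n) (Fin n) 𝕜, M = Bᴴ * B := by
  have hA := hM.1
  have hsp := hA.spectral_theorem
  rw [Unitary.conjStarAlgAut_apply] at hsp
  refine ⟨diagonal (fun i => ((√(hA.eigenvalues i) : ℝ) : 𝕜)) *
    (hA.eigenvectorUnitary : Matrix (Fin n) (Fin n) 𝕜)ᴴ, ?_⟩
  conv_lhs => rw [hsp]
  rw [conjTranspose_mul, conjTranspose_conjTranspose, diagonal_conjTranspose,
    Matrix.mul_assoc, Matrix.mul_assoc, ← Matrix.mul_assoc (diagonal _) (diagonal _),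
    diagonal_mul_diagonal]
  congr 3
  ext i
  simp only [Function.comp, Pi.star_apply, RCLike.star_def, RCLike.conj_ofReal]
  rw [← RCLike.ofReal_mul, Real.mul_self_sqrt (hM.posSemidef.eigenvalues_nonneg i)]

end Existence

/-! ### Lower bounds for concave costs -/

section Bounds

variable {m n : ℕ} {g : ℝ → ℝ}

lemma colSq_unitary {U : Matrix (Fin n) (Fin n) 𝕜} (hU : U ∈ unitaryGroup (Fin n) 𝕜)
    (j : Fin n) : colSq U j = 1 := by
  have h := conjTranspose_mul_self_apply U j
  have h1 : Uᴴ * U = 1 := mem_unitaryGroup_iff'.1 hU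
  rw [h1, one_apply_eq] at h
  exact_mod_cast h.symm

lemma gram_unitary_mul {U : Matrix (Fin m) (Fin m) 𝕜} (hU : U ∈ unitaryGroup (Fin m) 𝕜)
    (X : Matrix (Fin m) (Fin n) 𝕜) : (U * X)ᴴ * (U * X) = Xᴴ * X := by
  have h1 : Uᴴ * U = 1 := mem_unitaryGroup_iff'.1 hU
  rw [conjTranspose_mul, Matrix.mul_assoc, ← Matrix.mul_assoc Uᴴ, h1, Matrix.one_mul]

lemma colSq_unitary_mul {U : Matrix (Fin m) (Fin m) 𝕜} (hU : U ∈ unitaryGroup (Fin m) 𝕜)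
    (X : Matrix (Fin m) (Fin n) 𝕜) (j : Fin n) : colSq (U * X) j = colSq X j :=
  colSq_eq_of_gram_eq (gram_unitary_mul hU X) j

/-- `Dᴴ * D` is diagonal with entries `colSq D k`, so the quadratic form at a column of `B` is a
weighted sum of them. -/
lemma colSq_diag_mul {D : Matrix (Fin m) (Fin n) 𝕜} (hD : IsRectDiag D)
    (B : Matrix (Fin n) (Fin n) 𝕜) (j : Fin n) :
    colSq (D * B) j = ∑ k, ‖B k j‖ ^ 2 * colSq D k := by
  have h : (colSq (D * B) j : 𝕜) = ((∑ k, ‖B k j‖ ^ 2 * colSq D k : ℝ) : 𝕜) := by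
    rw [← conjTranspose_mul_self_apply, conjTranspose_mul, Matrix.mul_assoc,
      ← Matrix.mul_assoc Dᴴ, gram_eq_diagonal hD.transpose.colSparse, mul_apply]
    push_cast
    refine Finset.sum_congr rfl fun k _ => ?_
    rw [diagonal_mul, conjTranspose_apply, RCLike.star_def, mul_left_comm, RCLike.conj_mul,
      mul_comm]
  exact_mod_cast h

/-- The matrix of the `‖B k j‖ ^ 2` is doubly stochastic: its row sums split each term, and its
column sums provide the weights for Jensen. -/
lemma sum_colSq_diag_le (hg : ConcaveOn ℝ (Set.Ici 0) g) {D : Matrix (Fin m) (Fin n) 𝕜}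
    (hD : IsRectDiag D) {B : Matrix (Fin n) (Fin n) 𝕜} (hB : B ∈ unitaryGroup (Fin n) 𝕜) :
    ∑ k, g (colSq D k) ≤ ∑ j, g (colSq (D * B) j) := by
  calc ∑ k, g (colSq D k) = ∑ k, ∑ j, ‖B k j‖ ^ 2 * g (colSq D k) := by
        refine Finset.sum_congr rfl fun k _ => ?_
        have : ∑ j, ‖B k j‖ ^ 2 = 1 := colSq_unitary (transpose_mem_unitaryGroup hB) k
        rw [← Finset.sum_mul, this, one_mul]
    _ = ∑ j, ∑ k, ‖B k j‖ ^ 2 * g (colSq D k) := Finset.sum_comm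
    _ ≤ ∑ j, g (colSq (D * B) j) := Finset.sum_le_sum fun j _ => by
        rw [colSq_diag_mul hD]
        exact hg.le_map_sum (fun k _ => sq_nonneg _) (colSq_unitary hB j)
          fun k _ => colSq_nonneg D k

lemma sum_colSq_le_of_unitary (hg : ConcaveOn ℝ (Set.Ici 0) g) {D : Matrix (Fin m) (Fin n) 𝕜}
    (hD : IsRectDiag D) {A : Matrix (Fin m) (Fin m) 𝕜} (hA : A ∈ unitaryGroup (Fin m) 𝕜)
    {B : Matrix (Fin n) (Fin n) 𝕜} (hB : B ∈ unitaryGroup (Fin n) 𝕜) :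
    ∑ k, g (colSq D k) ≤ ∑ j, g (colSq (A * D * B) j) := by
  simp only [Matrix.mul_assoc, colSq_unitary_mul hA]
  exact sum_colSq_diag_le hg hD hB

lemma sqCost_diag_le_of_unitary (hg : ConcaveOn ℝ (Set.Ici 0) g) (h0 : g 0 = 0)
    {D : Matrix (Fin m) (Fin n) 𝕜} (hD : IsRectDiag D) {A : Matrix (Fin m) (Fin m) 𝕜}
    (hA : A ∈ unitaryGroup (Fin m) 𝕜) {B : Matrix (Fin n) (Fin n) 𝕜}
    (hB : B ∈ unitaryGroup (Fin n) 𝕜) : sqCost g D ≤ sqCost g (A * D * B) := by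
  rw [hD.colSparse.sqCost_eq h0]
  exact (sum_colSq_le_of_unitary hg hD hA hB).trans (sum_colSq_le_sqCost hg h0 _)

lemma colSparse_of_unitary (hg : StrictConcaveOn ℝ (Set.Ici 0) g) (h0 : g 0 = 0)
    {D : Matrix (Fin m) (Fin n) 𝕜} (hD : IsRectDiag D) {A : Matrix (Fin m) (Fin m) 𝕜}
    (hA : A ∈ unitaryGroup (Fin m) 𝕜) {B : Matrix (Fin n) (Fin n) 𝕜}
    (hB : B ∈ unitaryGroup (Fin n) 𝕜) (h : sqCost g (A * D * B) ≤ sqCost g D) :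
    ColSparse (A * D * B) := by
  rw [hD.colSparse.sqCost_eq h0] at h
  exact colSparse_of_sqCost_le hg h0 (h.trans (sum_colSq_le_of_unitary hg.concaveOn hD hA hB))

/-- A matrix unitarily equivalent to a diagonal matrix and of the same strictly concave cost is
a permutation of that matrix up to the phases of the entries. -/
theorem exists_perms_of_unitary (hg : StrictConcaveOn ℝ (Set.Ici 0) g) (h0 : g 0 = 0)
    {D : Matrix (Fin m) (Fin n) 𝕜} (hD : IsRectDiag D) {A : Matrix (Fin m) (Fin m) 𝕜}
    (hA : A ∈ unitaryGroup (Fin m) 𝕜) {B : Matrix (Fin n) (Fin n) 𝕜}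
    (hB : B ∈ unitaryGroup (Fin n) 𝕜) (h : sqCost g (A * D * B) ≤ sqCost g D) :
    ∃ (σ : Equiv.Perm (Fin m)) (τ : Equiv.Perm (Fin n)),
      ∀ i j, ‖(A * D * B) (σ i) (τ j)‖ = ‖D i j‖ := by
  have hX := colSparse_of_unitary hg h0 hD hA hB h
  have hT : (A * D * B)ᵀ = Bᵀ * Dᵀ * Aᵀ := by
    rw [transpose_mul, transpose_mul, Matrix.mul_assoc]
  -- The hypotheses are symmetric under transposition, so the rows are sparse as well.
  have hX' : ColSparse (A * D * B)ᵀ := by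
    rw [hT]
    refine colSparse_of_unitary hg h0 hD.transpose (transpose_mem_unitaryGroup hB)
      (transpose_mem_unitaryGroup hA) ?_
    rwa [← hT, sqCost_transpose, sqCost_transpose]
  have hgram : (A * D * B)ᴴ * (A * D * B) = Bᴴ * (Dᴴ * D) * B := by
    rw [Matrix.mul_assoc A, gram_unitary_mul hA, conjTranspose_mul]
    simp only [Matrix.mul_assoc]
  have hBB : B * Bᴴ = 1 := mem_unitaryGroup_iff.1 hB
  -- The two Gram matrices are similar through `B` and both diagonal, hence have the same diagonal
  -- up to a permutation.
  have hchar : ((A * D * B)ᴴ * (A * D * B)).charpoly = (Dᴴ * D).charpoly := by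
    rw [hgram, charpoly_mul_comm, ← Matrix.mul_assoc, hBB, Matrix.one_mul]
  rw [gram_eq_diagonal hX', gram_eq_diagonal hD.transpose.colSparse] at hchar
  obtain ⟨τ, hτ⟩ := exists_perm_of_charpoly_eq hchar
  obtain ⟨σ, hσ⟩ := exists_perm_norm_eq hX hX' hD τ fun j => by exact_mod_cast hτ j
  exact ⟨σ, τ, hσ⟩

/-- If g took equal values at two points, strict concavity would put the midpoint above the right
endpoint, against monotonicity. -/
lemma strictMonoOn_of_strictConcaveOn (hg : StrictConcaveOn ℝ (Set.Ici 0) g)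
    (hm : MonotoneOn g (Set.Ici 0)) : StrictMonoOn g (Set.Ici 0) := by
  intro x hx y hy hxy
  refine (hm hx hy hxy.le).lt_of_ne fun h => ?_
  have h1 := hg.2 hx hy hxy.ne (by norm_num : (0 : ℝ) < 1 / 2) (by norm_num : (0 : ℝ) < 1 / 2)
    (by norm_num)
  have hx' : (0 : ℝ) ≤ x := hx
  have h2 := hm (Set.mem_Ici.2 (by simp only [smul_eq_mul]; linarith)) hy
    (show (1 / 2 : ℝ) • x + (1 / 2 : ℝ) • y ≤ y by simp only [smul_eq_mul]; linarith)
  simp only [smul_eq_mul] at h1 h2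
  linarith

/-- Row i of `D * R` is a multiple of row i of `R`, so the unit diagonal of `R` suffices;
triangularity plays no role. -/
lemma diag_mul_upper_unit_apply {D : Matrix (Fin m) (Fin n) 𝕜} (hD : IsRectDiag D)
    {R : Matrix (Fin n) (Fin n) 𝕜} (h1 : ∀ i, R i i = 1) {i : Fin m} {j : Fin n}
    (hij : (i : ℕ) = j) : (D * R) i j = D i j := by
  rw [mul_apply, Finset.sum_eq_single j (fun k _ hk => ?_) (by simp), h1, mul_one]
  rw [hD i k fun h => hk (Fin.ext (h.symm.trans hij)), zero_mul]

lemma sq_norm_diag_le {D : Matrix (Fin m) (Fin n) 𝕜} (hD : IsRectDiag D)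
    {R : Matrix (Fin n) (Fin n) 𝕜} (h1 : ∀ i, R i i = 1) (i : Fin m) (j : Fin n) :
    ‖D i j‖ ^ 2 ≤ ‖(D * R) i j‖ ^ 2 := by
  by_cases hij : (i : ℕ) = j
  · rw [diag_mul_upper_unit_apply hD h1 hij]
  · rw [hD i j hij, norm_zero, zero_pow two_ne_zero]
    exact sq_nonneg _

lemma colSq_diag_le {D : Matrix (Fin m) (Fin n) 𝕜} (hD : IsRectDiag D)
    {R : Matrix (Fin n) (Fin n) 𝕜} (h1 : ∀ i, R i i = 1) (j : Fin n) :
    colSq D j ≤ colSq (D * R) j :=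
  Finset.sum_le_sum fun i _ => sq_norm_diag_le hD h1 i j

lemma sum_colSq_le_of_upper_unit (hm : MonotoneOn g (Set.Ici 0)) {D : Matrix (Fin m) (Fin n) 𝕜}
    (hD : IsRectDiag D) {A : Matrix (Fin m) (Fin m) 𝕜} (hA : A ∈ unitaryGroup (Fin m) 𝕜)
    {R : Matrix (Fin n) (Fin n) 𝕜} (h1 : ∀ i, R i i = 1) :
    ∑ j, g (colSq D j) ≤ ∑ j, g (colSq (A * D * R) j) := by
  simp only [Matrix.mul_assoc, colSq_unitary_mul hA]
  exact Finset.sum_le_sum fun j _ =>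
    hm (colSq_nonneg _ j) (colSq_nonneg _ j) (colSq_diag_le hD h1 j)

lemma sqCost_diag_le_of_upper_unit (hg : ConcaveOn ℝ (Set.Ici 0) g)
    (hm : MonotoneOn g (Set.Ici 0)) (h0 : g 0 = 0) {D : Matrix (Fin m) (Fin n) 𝕜}
    (hD : IsRectDiag D) {A : Matrix (Fin m) (Fin m) 𝕜} (hA : A ∈ unitaryGroup (Fin m) 𝕜)
    {R : Matrix (Fin n) (Fin n) 𝕜} (h1 : ∀ i, R i i = 1) :
    sqCost g D ≤ sqCost g (A * D * R) := by
  rw [hD.colSparse.sqCost_eq h0]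
  exact (sum_colSq_le_of_upper_unit hm hD hA h1).trans (sum_colSq_le_sqCost hg h0 _)

/-- If `A * D * R`, with `A` unitary and `R` of unit diagonal, has the same strictly concave and
increasing cost as the diagonal matrix `D`, then it is a permutation of `D` up to the phases of
the entries. -/
theorem exists_perm_of_upper_unit (hg : StrictConcaveOn ℝ (Set.Ici 0) g)
    (hm : MonotoneOn g (Set.Ici 0)) (h0 : g 0 = 0) {D : Matrix (Fin m) (Fin n) 𝕜}
    (hD : IsRectDiag D) {A : Matrix (Fin m) (Fin m) 𝕜} (hA : A ∈ unitaryGroup (Fin m) 𝕜)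
    {R : Matrix (Fin n) (Fin n) 𝕜} (h1 : ∀ i, R i i = 1)
    (h : sqCost g (A * D * R) ≤ sqCost g D) :
    ∃ σ : Equiv.Perm (Fin m), ∀ i j, ‖(A * D * R) (σ i) j‖ = ‖D i j‖ := by
  rw [hD.colSparse.sqCost_eq h0] at h
  have hX := colSparse_of_sqCost_le hg h0 (h.trans (sum_colSq_le_of_upper_unit hm hD hA h1))
  have hle := (sum_colSq_le_sqCost hg.concaveOn h0 (A * D * R)).trans h
  simp only [Matrix.mul_assoc, colSq_unitary_mul hA] at hle
  have hle' : ∀ j ∈ Finset.univ, g (colSq D j) ≤ g (colSq (D * R) j) := fun j _ =>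
    hm (colSq_nonneg _ j) (colSq_nonneg _ j) (colSq_diag_le hD h1 j)
  have hcol : ∀ j, colSq D j = colSq (D * R) j := fun j =>
    (strictMonoOn_of_strictConcaveOn hg hm).injOn (colSq_nonneg _ j) (colSq_nonneg _ j)
      ((Finset.sum_eq_sum_iff_of_le hle').1 (le_antisymm (Finset.sum_le_sum hle') hle) j
        (Finset.mem_univ j))
  -- The column norms agree and the diagonal entries already account for them, so the other entries
  -- vanish.
  have hDR : D * R = D := by
    ext i j
    by_cases hij : (i : ℕ) = j
    · exact diag_mul_upper_unit_apply hD h1 hij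
    · have := (Finset.sum_eq_sum_iff_of_le fun i _ => sq_norm_diag_le hD h1 i j).1 (hcol j) i
        (Finset.mem_univ i)
      rw [hD i j hij, norm_zero, zero_pow two_ne_zero] at this
      rw [hD i j hij]
      exact norm_eq_zero.1 (pow_eq_zero_iff two_ne_zero |>.1 this.symm)
  rw [Matrix.mul_assoc, hDR] at hX ⊢
  have hgram : (A * D)ᴴ * (A * D) = Dᴴ * D := gram_unitary_mul hA D
  -- Row sparsity: the columns of `A * D` are orthogonal. If two of them met in row i, column
  -- sparsity would reduce their inner product to that single nonzero term.
  refine exists_perm_norm_eq hX (fun i j k hjk => ?_) hD 1 fun j => colSq_eq_of_gram_eq hgram j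
  by_contra! hne
  simp only [transpose_apply] at hne
  have hz : ((A * D)ᴴ * (A * D)) j k = 0 := by
    rw [hgram, gram_eq_diagonal hD.transpose.colSparse, diagonal_apply_ne _ hjk]
  rw [mul_apply, Finset.sum_eq_single i (fun l _ hl => ?_) (by simp), conjTranspose_apply] at hz
  · rcases mul_eq_zero.1 hz with hz | hz
    exacts [hne.1 (star_eq_zero.1 hz), hne.2 hz]
  · rw [(hX k l i hl).resolve_right hne.2, mul_zero]

/-- **Hadamard's inequality**. -/
theorem sq_norm_det_le_prod_colSq (X : Matrix (Fin n) (Fin n) 𝕜) :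
    ‖X.det‖ ^ 2 ≤ ∏ j, colSq X j := by
  -- In `Q * D * R` the modulus of the determinant is that of `∏ D j j`, and each `‖D j j‖ ^ 2` is
  -- at most the squared norm of column j.
  obtain ⟨Q, hQ, D, R, hD, hR, h1, rfl⟩ := exists_qdr le_rfl X
  have hdiag : D = diagonal fun i => D i i := by
    ext i j
    rcases eq_or_ne i j with rfl | h
    · simp
    · rw [diagonal_apply_ne _ h, hD i j fun e => h (Fin.ext e)]
  have hdet : D.det = ∏ j, D j j := by
    conv_lhs => rw [hdiag]
    exact det_diagonal
  rw [det_mul, det_mul, det_upper_unit hR h1, mul_one, norm_mul, norm_det_unitary hQ, one_mul,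
    hdet, norm_prod, ← Finset.prod_pow]
  refine Finset.prod_le_prod (fun j _ => sq_nonneg _) fun j _ => ?_
  rw [Matrix.mul_assoc, colSq_unitary_mul hQ]
  exact (Finset.single_le_sum (f := fun i => ‖D i j‖ ^ 2) (fun i _ => sq_nonneg _)
    (Finset.mem_univ j)).trans (colSq_diag_le hD h1 j)

lemma colSq_pos_of_det_ne_zero {X : Matrix (Fin n) (Fin n) 𝕜} (hX : X.det ≠ 0) (j : Fin n) :
    0 < colSq X j :=
  (colSq_nonneg X j).lt_of_ne' fun h => hX (det_eq_zero_of_column_eq_zero j (colSq_eq_zero.1 h))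

/-- Hadamard's inequality in logarithmic form, ready for Jensen with equal weights. -/
lemma log_le_mean_log_colSq [NeZero n] {X : Matrix (Fin n) (Fin n) 𝕜} (hX : X.det ≠ 0) {r : ℝ}
    (hrX : r ^ n = ‖X.det‖) :
    Real.log (r ^ 2) ≤ ∑ j, (n : ℝ)⁻¹ • Real.log (colSq X j) := by
  have hn : (0 : ℝ) < n := Nat.cast_pos.2 (NeZero.pos n)
  have h := Real.log_le_log (by positivity) (sq_norm_det_le_prod_colSq X)
  rw [Real.log_prod fun j _ => (colSq_pos_of_det_ne_zero hX j).ne', ← hrX, ← pow_mul, mul_comm n,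
    pow_mul, Real.log_pow] at h
  rw [← Finset.smul_sum, smul_eq_mul, le_inv_mul_iff₀ hn]
  exact h

/-- Exponentiate the logarithmic bound, apply the monotone g, then use Jensen for x ↦ g(eˣ). -/
lemma mul_le_sum_colSq (hm : MonotoneOn g (Set.Ici 0))
    (hc : ConvexOn ℝ Set.univ fun x => g (Real.exp x)) {X : Matrix (Fin n) (Fin n) 𝕜}
    (hX : X.det ≠ 0) {r : ℝ} (hr : 0 < r) (hrX : r ^ n = ‖X.det‖) :
    n * g (r ^ 2) ≤ ∑ j, g (colSq X j) := by
  rcases Nat.eq_zero_or_pos n with rfl | hn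
  · simp
  have : NeZero n := ⟨hn.ne'⟩
  have hn' : (0 : ℝ) < n := Nat.cast_pos.2 hn
  have h1 := log_le_mean_log_colSq hX hrX
  have h2 := hc.map_sum_le (t := Finset.univ) (w := fun _ : Fin n => (n : ℝ)⁻¹)
    (p := fun j => Real.log (colSq X j)) (fun _ _ => by positivity) (by simp [hn'.ne'])
    fun _ _ => Set.mem_univ _
  have h3 := hm (Set.mem_Ici.2 (Real.exp_pos _).le) (Set.mem_Ici.2 (Real.exp_pos _).le)
    (Real.exp_le_exp.2 h1)
  rw [Real.exp_log (by positivity)] at h3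
  have h4 := h3.trans h2
  simp only [Real.exp_log (colSq_pos_of_det_ne_zero hX _)] at h4
  rwa [← Finset.smul_sum, smul_eq_mul, le_inv_mul_iff₀ hn'] at h4

/-- The equality case of `mul_le_sum_colSq`. -/
lemma colSq_eq_of_sum_colSq_le (hm : MonotoneOn g (Set.Ici 0))
    (hc : StrictConvexOn ℝ Set.univ fun x => g (Real.exp x)) {X : Matrix (Fin n) (Fin n) 𝕜}
    (hX : X.det ≠ 0) {r : ℝ} (hr : 0 < r) (hrX : r ^ n = ‖X.det‖)
    (h : ∑ j, g (colSq X j) ≤ n * g (r ^ 2)) (i j : Fin n) : colSq X i = colSq X j := by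
  have hn : 0 < n := i.pos
  have : NeZero n := ⟨hn.ne'⟩
  have hn' : (0 : ℝ) < n := Nat.cast_pos.2 hn
  have h1 := log_le_mean_log_colSq hX hrX
  have h3 := hm (Set.mem_Ici.2 (Real.exp_pos _).le) (Set.mem_Ici.2 (Real.exp_pos _).le)
    (Real.exp_le_exp.2 h1)
  rw [Real.exp_log (by positivity)] at h3
  -- The assumed bound is the reverse of Jensen's inequality, so strict convexity makes the
  -- logarithms equal.
  have h2 := hc.eq_of_le_map_sum (t := Finset.univ) (w := fun _ : Fin n => (n : ℝ)⁻¹)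
    (p := fun j => Real.log (colSq X j)) (fun _ _ => by positivity) (by simp [hn'.ne'])
    (fun _ _ => Set.mem_univ _) ?_ (Finset.mem_univ i) (Finset.mem_univ j)
  · exact Real.log_injOn_pos (colSq_pos_of_det_ne_zero hX i) (colSq_pos_of_det_ne_zero hX j) h2
  · refine le_trans ?_ h3
    simp only [Real.exp_log (colSq_pos_of_det_ne_zero hX _)]
    rwa [← Finset.smul_sum, smul_eq_mul, inv_mul_le_iff₀ hn']

end Bounds

/-! ### Unit groups -/

section UnitGroups

variable {m n : ℕ}

lemma coe_conjGL (g : GL (Fin n) 𝕜) : (conjGL g : Matrix (Fin n) (Fin n) 𝕜) =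
    (g : Matrix (Fin n) (Fin n) 𝕜)ᴴᵀ := by
  ext i j
  simp [conjGL]

lemma conjGL_mem_unitaryGroup {g : GL (Fin n) 𝕜} (hg : g ∈ unitaryGL 𝕜 n) :
    (conjGL g : Matrix (Fin n) (Fin n) 𝕜) ∈ unitaryGroup (Fin n) 𝕜 := by
  rw [coe_conjGL]
  exact transpose_mem_unitaryGroup (conjTranspose_mem_unitaryGroup (mem_unitaryGL.1 hg))

lemma det_of_mem_lowerUnitGL {g : GL (Fin n) 𝕜} (hg : g ∈ lowerUnitGL 𝕜 n) :
    (g : Matrix (Fin n) (Fin n) 𝕜).det = 1 := by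
  rw [← det_transpose]
  exact det_upper_unit hg.1 hg.2

lemma isUnitGroup_map_kroneckerGL {H : Subgroup (GL (Fin n) 𝕜 × GL (Fin m) 𝕜)}
    (h : ∀ G ∈ H, ‖(G.1 : Matrix (Fin n) (Fin n) 𝕜).det‖ = 1 ∧
      ‖(G.2 : Matrix (Fin m) (Fin m) 𝕜).det‖ = 1) : IsUnitGroup (H.map kroneckerGL) := by
  rintro _ ⟨G, hG, rfl⟩
  have : (kroneckerGL G : Matrix (Fin n × Fin m) (Fin n × Fin m) 𝕜) =
    (G.1 : Matrix (Fin n) (Fin n) 𝕜) ⊗ₖ (G.2 : Matrix (Fin m) (Fin m) 𝕜) := rfl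
  rw [this, det_kronecker, norm_mul, norm_pow, norm_pow, (h G hG).1, (h G hG).2, one_pow, one_pow,
    one_mul]

lemma svdGroup_unitary {G : GL (Fin n) 𝕜 × GL (Fin m) 𝕜} (hG : G ∈ svdGroup 𝕜 m n) :
    (G.1 : Matrix (Fin n) (Fin n) 𝕜) ∈ unitaryGroup (Fin n) 𝕜 ∧
      (G.2 : Matrix (Fin m) (Fin m) 𝕜) ∈ unitaryGroup (Fin m) 𝕜 := by
  obtain ⟨⟨V, hV, h⟩, h2⟩ := hG
  refine ⟨?_, mem_unitaryGL.1 h2⟩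
  rw [← h]
  exact conjGL_mem_unitaryGroup hV

theorem isUnitGroups (𝕜 : Type*) [RCLike 𝕜] (m n : ℕ) :
    IsUnitGroup ((svdGroup 𝕜 m n).map kroneckerGL) ∧
    IsUnitGroup ((qrGroup 𝕜 m n).map kroneckerGL) ∧
    IsUnitGroup ((equivGroup 𝕜 n).map kroneckerGL) ∧
    IsUnitGroup ((luGroup 𝕜 m n).map kroneckerGL) ∧
    IsUnitGroup ((schurGroup 𝕜 n).map kroneckerGL) := by
  refine ⟨?_, ?_, ?_, ?_, ?_⟩ <;> refine isUnitGroup_map_kroneckerGL fun G hG => ?_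
  · exact ⟨norm_det_unitary (svdGroup_unitary hG).1, norm_det_unitary (svdGroup_unitary hG).2⟩
  · refine ⟨?_, norm_det_unitary (mem_unitaryGL.1 hG.2)⟩
    rw [det_of_mem_lowerUnitGL hG.1, norm_one]
  · rw [mem_specialGL.1 hG.1, mem_specialGL.1 hG.2, norm_one]
    exact ⟨rfl, rfl⟩
  · rw [det_of_mem_lowerUnitGL hG.2, Subgroup.mem_bot.1 hG.1]
    simp
  · obtain ⟨Q, hQ, rfl⟩ := hG
    exact ⟨norm_det_unitary (conjGL_mem_unitaryGroup hQ), norm_det_unitary (mem_unitaryGL.1 hQ)⟩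

end UnitGroups

/-! ### Minimizers of entrywise costs -/

section Minimizers

variable {m n : ℕ} {f : ℝ → ℝ}

lemma strictConcaveOn_sub_const {g : ℝ → ℝ} {s : Set ℝ} (hg : StrictConcaveOn ℝ s g) (c : ℝ) :
    StrictConcaveOn ℝ s fun x => g x - c := by
  rw [show (fun x => g x - c) = g + fun _ => -c from funext fun x => sub_eq_add_neg _ _]
  exact hg.add_const (-c)

lemma convexOn_sub_const {g : ℝ → ℝ} {s : Set ℝ} (hg : ConvexOn ℝ s g) (c : ℝ) :
    ConvexOn ℝ s fun x => g x - c := by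
  rw [show (fun x => g x - c) = g + fun _ => -c from funext fun x => sub_eq_add_neg _ _]
  exact hg.add_const (-c)

lemma strictConvexOn_sub_const {g : ℝ → ℝ} {s : Set ℝ} (hg : StrictConvexOn ℝ s g) (c : ℝ) :
    StrictConvexOn ℝ s fun x => g x - c := by
  rw [show (fun x => g x - c) = g + fun _ => -c from funext fun x => sub_eq_add_neg _ _]
  exact hg.add_const (-c)

lemma monotoneOn_sub_const {g : ℝ → ℝ} {s : Set ℝ} (hg : MonotoneOn g s) (c : ℝ) :
    MonotoneOn (fun x => g x - c) s :=
  fun _ hx _ hy h => sub_le_sub_right (hg hx hy h) c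

lemma cost_le_cost_iff (X Y : Matrix (Fin m) (Fin n) 𝕜) :
    cost f X ≤ cost f Y ↔
      sqCost (fun x => f (√x) - f 0) X ≤ sqCost (fun x => f (√x) - f 0) Y := by
  rw [cost_eq_sqCost, cost_eq_sqCost, add_le_add_iff_right]

/-- For unitary V the inverse of the conjugate is the transpose, and the transpose in `act` restores
V itself. -/
lemma act_conjGL_inv {U : GL (Fin m) 𝕜} (hU : U ∈ unitaryGL 𝕜 m) {V : GL (Fin n) 𝕜}
    (hV : V ∈ unitaryGL 𝕜 n) (M : Matrix (Fin m) (Fin n) 𝕜) :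
    act (conjGL V, U)⁻¹ M =
      (U : Matrix (Fin m) (Fin m) 𝕜)ᴴ * M * (V : Matrix (Fin n) (Fin n) 𝕜) := by
  change ((U⁻¹ : GL (Fin m) 𝕜) : Matrix (Fin m) (Fin m) 𝕜) * M *
    (((conjGL V)⁻¹ : GL (Fin n) 𝕜) : Matrix (Fin n) (Fin n) 𝕜)ᵀ = _
  rw [← map_inv, coe_conjGL, transpose_transpose, coe_inv_of_mem_unitaryGL hU,
    coe_inv_of_mem_unitaryGL hV, conjTranspose_conjTranspose]

lemma act_transposeGL_inv (P : GL (Fin m) 𝕜) (Q : GL (Fin n) 𝕜) (M : Matrix (Fin m) (Fin n) 𝕜) :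
    act (transposeGL Q, P)⁻¹ M = ((P⁻¹ : GL (Fin m) 𝕜) : Matrix (Fin m) (Fin m) 𝕜) * M *
      ((Q⁻¹ : GL (Fin n) 𝕜) : Matrix (Fin n) (Fin n) 𝕜) :=
  rfl

lemma inv_mul_mul_inv_eq {P : GL (Fin m) 𝕜} {Q : GL (Fin n) 𝕜} {M D : Matrix (Fin m) (Fin n) 𝕜}
    (h : M = (P : Matrix (Fin m) (Fin m) 𝕜) * D * (Q : Matrix (Fin n) (Fin n) 𝕜)) :
    ((P⁻¹ : GL (Fin m) 𝕜) : Matrix (Fin m) (Fin m) 𝕜) * M *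
      ((Q⁻¹ : GL (Fin n) 𝕜) : Matrix (Fin n) (Fin n) 𝕜) = D := by
  rw [h, Matrix.mul_assoc, Matrix.mul_assoc, Matrix.mul_assoc, Units.mul_inv, Matrix.mul_one,
    ← Matrix.mul_assoc, Units.inv_mul, Matrix.one_mul]

lemma mul_inv_mul_mul_inv_mul (P : GL (Fin m) 𝕜) (Q : GL (Fin n) 𝕜)
    (M : Matrix (Fin m) (Fin n) 𝕜) :
    (P : Matrix (Fin m) (Fin m) 𝕜) * (((P⁻¹ : GL (Fin m) 𝕜) : Matrix (Fin m) (Fin m) 𝕜) * M *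
      ((Q⁻¹ : GL (Fin n) 𝕜) : Matrix (Fin n) (Fin n) 𝕜)) *
      (Q : Matrix (Fin n) (Fin n) 𝕜) = M := by
  rw [Matrix.mul_assoc, Matrix.mul_assoc, Matrix.mul_assoc, Units.inv_mul, Matrix.mul_one,
    ← Matrix.mul_assoc, Units.mul_inv, Matrix.one_mul]

theorem svd_minimizer (hf : StrictConcaveOn ℝ (Set.Ici 0) fun x => f (√x))
    {M : Matrix (Fin m) (Fin n) 𝕜} {U : GL (Fin m) 𝕜} (hU : U ∈ unitaryGL 𝕜 m)
    {V : GL (Fin n) 𝕜} (hV : V ∈ unitaryGL 𝕜 n) {D : Matrix (Fin m) (Fin n) 𝕜}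
    (hD : IsRectDiag D)
    (hM : M = (U : Matrix (Fin m) (Fin m) 𝕜) * D * (V : Matrix (Fin n) (Fin n) 𝕜)ᴴ) :
    IsMinimizer (svdGroup 𝕜 m n) (cost f) M (conjGL V, U)⁻¹ ∧
      ∀ U' ∈ unitaryGL 𝕜 m, ∀ V' ∈ unitaryGL 𝕜 n,
        IsMinimizer (svdGroup 𝕜 m n) (cost f) M (conjGL V', U')⁻¹ →
        ∃ (σ : Equiv.Perm (Fin m)) (τ : Equiv.Perm (Fin n)) (Z : Matrix (Fin m) (Fin n) 𝕜),
          IsRectDiag Z ∧ (∀ i j, ‖Z i j‖ = ‖D i j‖) ∧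
          M = ((U' : Matrix (Fin m) (Fin m) 𝕜) * σ.permMatrix 𝕜) * Z *
            ((V' : Matrix (Fin n) (Fin n) 𝕜) * τ.permMatrix 𝕜)ᴴ := by
  have hg := strictConcaveOn_sub_const hf (f 0)
  have h0 : f (√0) - f 0 = 0 := by rw [Real.sqrt_zero, sub_self]
  have hUu := mem_unitaryGL.1 hU
  have hVu := mem_unitaryGL.1 hV
  have hmem : (conjGL V, U)⁻¹ ∈ svdGroup 𝕜 m n := inv_mem ⟨⟨V, hV, rfl⟩, hU⟩
  have hact : act (conjGL V, U)⁻¹ M = D := by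
    have h1 : (U : Matrix (Fin m) (Fin m) 𝕜)ᴴ * (U : Matrix (Fin m) (Fin m) 𝕜) = 1 :=
      mem_unitaryGroup_iff'.1 hUu
    have h2 : (V : Matrix (Fin n) (Fin n) 𝕜)ᴴ * (V : Matrix (Fin n) (Fin n) 𝕜) = 1 :=
      mem_unitaryGroup_iff'.1 hVu
    rw [act_conjGL_inv hU hV, hM]
    simp only [Matrix.mul_assoc, h2, Matrix.mul_one]
    rw [← Matrix.mul_assoc, h1, Matrix.one_mul]
  -- Every point of the orbit is `D` between two unitary matrices when G is in the group.
  have hact' : ∀ G : GL (Fin n) 𝕜 × GL (Fin m) 𝕜, act G M =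
      ((G.2 : Matrix (Fin m) (Fin m) 𝕜) * (U : Matrix (Fin m) (Fin m) 𝕜)) * D *
      ((V : Matrix (Fin n) (Fin n) 𝕜)ᴴ * (G.1 : Matrix (Fin n) (Fin n) 𝕜)ᵀ) := fun G => by
    rw [act, hM]
    simp only [Matrix.mul_assoc]
  have hV' := conjTranspose_mem_unitaryGroup hVu
  refine ⟨⟨hmem, fun G hG => ?_⟩, fun U' hU' V' hV'' hmin => ?_⟩
  · obtain ⟨h1, h2⟩ := svdGroup_unitary hG
    rw [hact, hact' G, cost_le_cost_iff]
    exact sqCost_diag_le_of_unitary hg.concaveOn h0 hD (mul_mem h2 hUu)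
      (mul_mem hV' (transpose_mem_unitaryGroup h1))
  · have hle := hmin.2 _ hmem
    obtain ⟨h1, h2⟩ := svdGroup_unitary hmin.1
    rw [hact, hact', cost_le_cost_iff] at hle
    obtain ⟨σ, τ, h⟩ := exists_perms_of_unitary hg h0 hD (mul_mem h2 hUu)
      (mul_mem hV' (transpose_mem_unitaryGroup h1)) hle
    rw [← hact', act_conjGL_inv hU' hV''] at h
    set X := (U' : Matrix (Fin m) (Fin m) 𝕜)ᴴ * M * (V' : Matrix (Fin n) (Fin n) 𝕜) with hX
    -- Z is the minimizing matrix with rows and columns reindexed; the inverse permutations undo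
    -- this.
    refine ⟨σ⁻¹, τ⁻¹, X.submatrix σ τ, fun i j hij => ?_, h, ?_⟩
    · rw [← norm_eq_zero]
      refine (h i j).trans ?_
      rw [hD i j hij, norm_zero]
    · have e : (U' : Matrix (Fin m) (Fin m) 𝕜) * σ⁻¹.permMatrix 𝕜 * X.submatrix σ τ *
          ((V' : Matrix (Fin n) (Fin n) 𝕜) * τ⁻¹.permMatrix 𝕜)ᴴ =
          (U' : Matrix (Fin m) (Fin m) 𝕜) * (σ⁻¹.permMatrix 𝕜 * X.submatrix σ τ *
            (τ⁻¹.permMatrix 𝕜)ᴴ) * (V' : Matrix (Fin n) (Fin n) 𝕜)ᴴ := by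
        rw [conjTranspose_mul]
        simp only [Matrix.mul_assoc]
      have h1 : (U' : Matrix (Fin m) (Fin m) 𝕜) * (U' : Matrix (Fin m) (Fin m) 𝕜)ᴴ = 1 :=
        mem_unitaryGroup_iff.1 (mem_unitaryGL.1 hU')
      have h2 : (V' : Matrix (Fin n) (Fin n) 𝕜) * (V' : Matrix (Fin n) (Fin n) 𝕜)ᴴ = 1 :=
        mem_unitaryGroup_iff.1 (mem_unitaryGL.1 hV'')
      rw [e, permMatrix_mul_mul_permMatrix, hX]
      simp only [Matrix.mul_assoc, h2, Matrix.mul_one]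
      rw [← Matrix.mul_assoc, h1, Matrix.one_mul]

theorem qr_minimizer (hf : StrictConcaveOn ℝ (Set.Ici 0) fun x => f (√x))
    (hf' : MonotoneOn (fun x => f (√x)) (Set.Ici 0))
    {M : Matrix (Fin m) (Fin n) 𝕜} {Q : GL (Fin m) 𝕜} (hQ : Q ∈ unitaryGL 𝕜 m)
    {R : GL (Fin n) 𝕜} (hR : R ∈ upperUnitGL 𝕜 n) {D : Matrix (Fin m) (Fin n) 𝕜}
    (hD : IsRectDiag D)
    (hM : M = (Q : Matrix (Fin m) (Fin m) 𝕜) * D * (R : Matrix (Fin n) (Fin n) 𝕜)) :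
    IsMinimizer (qrGroup 𝕜 m n) (cost f) M (transposeGL R, Q)⁻¹ ∧
      ∀ Q' ∈ unitaryGL 𝕜 m, ∀ R' ∈ upperUnitGL 𝕜 n,
        IsMinimizer (qrGroup 𝕜 m n) (cost f) M (transposeGL R', Q')⁻¹ →
        ∃ (σ : Equiv.Perm (Fin m)) (Z : Matrix (Fin m) (Fin n) 𝕜),
          IsRectDiag Z ∧ (∀ i j, ‖Z i j‖ = ‖D i j‖) ∧
          M = ((Q' : Matrix (Fin m) (Fin m) 𝕜) * σ.permMatrix 𝕜) * Z *
            (R' : Matrix (Fin n) (Fin n) 𝕜) := by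
  have hg := strictConcaveOn_sub_const hf (f 0)
  have hm := monotoneOn_sub_const hf' (f 0)
  have h0 : f (√0) - f 0 = 0 := by rw [Real.sqrt_zero, sub_self]
  have hmem : (transposeGL R, Q)⁻¹ ∈ qrGroup 𝕜 m n :=
    inv_mem ⟨transposeGL_mem_lowerUnitGL.2 hR, hQ⟩
  have hact : act (transposeGL R, Q)⁻¹ M = D := inv_mul_mul_inv_eq hM
  -- For G in the group, `R * transposeGL G.1` is again upper triangular with unit diagonal.
  have hact' : ∀ G : GL (Fin n) 𝕜 × GL (Fin m) 𝕜, act G M =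
      ((G.2 : Matrix (Fin m) (Fin m) 𝕜) * (Q : Matrix (Fin m) (Fin m) 𝕜)) * D *
      ((R * transposeGL G.1 : GL (Fin n) 𝕜) : Matrix (Fin n) (Fin n) 𝕜) := fun G => by
    rw [act, hM, Units.val_mul]
    simp only [Matrix.mul_assoc]
    rfl
  refine ⟨⟨hmem, fun G hG => ?_⟩, fun Q' hQ' R' hR' hmin => ?_⟩
  · rw [hact, hact' G, cost_le_cost_iff]
    exact sqCost_diag_le_of_upper_unit hg.concaveOn hm h0 hD
      (mul_mem (mem_unitaryGL.1 hG.2) (mem_unitaryGL.1 hQ)) (mul_mem hR hG.1).2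
  · have hle := hmin.2 _ hmem
    rw [hact, hact', cost_le_cost_iff] at hle
    obtain ⟨σ, h⟩ := exists_perm_of_upper_unit hg hm h0 hD
      (mul_mem (mem_unitaryGL.1 hmin.1.2) (mem_unitaryGL.1 hQ)) (mul_mem hR hmin.1.1).2 hle
    rw [← hact', act_transposeGL_inv] at h
    have hMX := mul_inv_mul_mul_inv_mul Q' R' M
    set X := ((Q'⁻¹ : GL (Fin m) 𝕜) : Matrix (Fin m) (Fin m) 𝕜) * M *
      ((R'⁻¹ : GL (Fin n) 𝕜) : Matrix (Fin n) (Fin n) 𝕜)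
    refine ⟨σ⁻¹, X.submatrix σ id, fun i j hij => ?_, h, ?_⟩
    · rw [← norm_eq_zero]
      refine (h i j).trans ?_
      rw [hD i j hij, norm_zero]
    · have hp : σ⁻¹.permMatrix 𝕜 * X.submatrix σ id = X := by
        simpa using permMatrix_mul_mul_permMatrix X σ 1
      rw [Matrix.mul_assoc (Q' : Matrix (Fin m) (Fin m) 𝕜), hp, hMX]

end Minimizers

/-! ### Matrix equivalence -/

section Equivalence

variable {n : ℕ} {f g : ℝ → ℝ}

/-- The first entry carries the whole phase; for n = 0 the empty product forces c = 1. -/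
lemma exists_unimodular_prod_eq {c : 𝕜} (hc : ‖c‖ = 1) (h : n = 0 → c = 1) :
    ∃ δ : Fin n → 𝕜, (∀ i, ‖δ i‖ = 1) ∧ ∏ i, δ i = c := by
  rcases n with _ | n
  · exact ⟨1, fun i => i.elim0, by simp [h rfl]⟩
  · refine ⟨fun i => if i = 0 then c else 1, fun i => ?_, by simp⟩
    dsimp only
    split_ifs <;> simp [hc]

lemma exists_pos_pow_eq_norm_det {M : Matrix (Fin n) (Fin n) 𝕜} (hM : M.det ≠ 0) :
    ∃ r : ℝ, 0 < r ∧ r ^ n = ‖M.det‖ := by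
  rcases Nat.eq_zero_or_pos n with rfl | hn
  · exact ⟨1, one_pos, by simp⟩
  · exact ⟨‖M.det‖ ^ ((n : ℝ)⁻¹), Real.rpow_pos_of_pos (norm_pos_iff.2 hM) _,
      Real.rpow_inv_natCast_pow (norm_nonneg _) hn.ne'⟩

/-- `P = M * D⁻¹` has determinant one, and `Q = 1` serves as the other factor. -/
lemma exists_specialGL_mul {M D : Matrix (Fin n) (Fin n) 𝕜} (hM : M.det ≠ 0)
    (h : D.det = M.det) : ∃ P ∈ specialGL 𝕜 n, ∃ Q ∈ specialGL 𝕜 n,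
      M = (P : Matrix (Fin n) (Fin n) 𝕜) * D * (Q : Matrix (Fin n) (Fin n) 𝕜) := by
  have hD : IsUnit D.det := by rw [h]; exact hM.isUnit
  obtain ⟨P, hP, hP'⟩ := exists_specialGL (P := M * D⁻¹) (by
    rw [det_mul, det_nonsing_inv, Ring.inverse_eq_inv', h, mul_inv_cancel₀ hM])
  refine ⟨P, hP, 1, one_mem _, ?_⟩
  rw [hP', Units.val_one, Matrix.mul_one, Matrix.mul_assoc, nonsing_inv_mul _ hD, Matrix.mul_one]

theorem exists_equiv_diag {M : Matrix (Fin n) (Fin n) 𝕜} (hM : M.det ≠ 0) :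
    ∃ P ∈ specialGL 𝕜 n, ∃ Q ∈ specialGL 𝕜 n, ∃ D : Matrix (Fin n) (Fin n) 𝕜,
      D.IsDiag ∧ (∀ i, ‖D i i‖ ^ n = ‖M.det‖) ∧
      M = (P : Matrix (Fin n) (Fin n) 𝕜) * D * (Q : Matrix (Fin n) (Fin n) 𝕜) := by
  obtain ⟨r, hr, hrM⟩ := exists_pos_pow_eq_norm_det hM
  have hn : ((‖M.det‖ : ℝ) : 𝕜) ≠ 0 := by exact_mod_cast norm_ne_zero_iff.2 hM
  -- An n-th root of the determinant may not exist over ℝ, so D gets modulus `r` throughout and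
  -- phases whose product is that of the determinant.
  obtain ⟨δ, hδ, hδM⟩ := exists_unimodular_prod_eq (n := n) (c := M.det / (‖M.det‖ : ℝ))
    (by rw [norm_div, RCLike.norm_ofReal, abs_norm, div_self (norm_ne_zero_iff.2 hM)])
    (by rintro rfl; simp)
  have hdet : (diagonal fun i => (r : 𝕜) * δ i).det = M.det := by
    rw [det_diagonal, Finset.prod_mul_distrib, hδM, Finset.prod_const, Finset.card_univ,
      Fintype.card_fin, ← RCLike.ofReal_pow, hrM, mul_div_cancel₀ _ hn]
  obtain ⟨P, hP, Q, hQ, h⟩ := exists_specialGL_mul hM hdet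
  refine ⟨P, hP, Q, hQ, _, isDiag_diagonal _, fun i => ?_, h⟩
  rw [diagonal_apply_eq, norm_mul, hδ, mul_one, RCLike.norm_ofReal, abs_of_pos hr, hrM]

lemma IsDiag.isRectDiag {D : Matrix (Fin n) (Fin n) 𝕜} (hD : D.IsDiag) : IsRectDiag D :=
  fun _ _ h => hD fun e => h (congrArg _ e)

lemma colSq_of_isDiag {D : Matrix (Fin n) (Fin n) 𝕜} (hD : D.IsDiag) (j : Fin n) :
    colSq D j = ‖D j j‖ ^ 2 :=
  Finset.sum_eq_single j (fun i _ h => by rw [hD h, norm_zero, zero_pow two_ne_zero]) (by simp)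

lemma sqCost_of_isDiag (h0 : g 0 = 0) {D : Matrix (Fin n) (Fin n) 𝕜} (hD : D.IsDiag) {r d : ℝ}
    (hr : 0 < r) (hrd : r ^ n = d) (h : ∀ i, ‖D i i‖ ^ n = d) :
    sqCost g D = n * g (r ^ 2) := by
  rw [(IsDiag.isRectDiag hD).colSparse.sqCost_eq h0]
  have : ∀ j, colSq D j = r ^ 2 := fun j => by
    rw [colSq_of_isDiag hD, (pow_left_inj₀ (norm_nonneg _) hr.le j.pos.ne').1
      ((h j).trans hrd.symm)]
  simp [this]

theorem equiv_minimizer (hg : StrictConcaveOn ℝ (Set.Ici 0) g) (h0 : g 0 = 0)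
    (hm : MonotoneOn g (Set.Ici 0)) (hc : ConvexOn ℝ Set.univ fun x => g (Real.exp x))
    {X : Matrix (Fin n) (Fin n) 𝕜} (hX : X.det ≠ 0) {r : ℝ} (hr : 0 < r)
    (hrX : r ^ n = ‖X.det‖) (h : sqCost g X ≤ n * g (r ^ 2)) :
    ∃ W ∈ specialGL 𝕜 n, ∃ D : Matrix (Fin n) (Fin n) 𝕜,
      IsUnimodularMonomial (W : Matrix (Fin n) (Fin n) 𝕜) ∧ D.IsDiag ∧
      X = (W : Matrix (Fin n) (Fin n) 𝕜) * D ∧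
      (StrictConvexOn ℝ Set.univ (fun x => g (Real.exp x)) → ∀ i, ‖D i i‖ ^ n = ‖X.det‖) := by
  have hsp : ∀ Y : Matrix (Fin n) (Fin n) 𝕜, Y.det = X.det → sqCost g Y ≤ n * g (r ^ 2) →
      ColSparse Y := fun Y hY h => colSparse_of_sqCost_le hg h0 <| h.trans <|
    mul_le_sum_colSq hm hc (by rwa [hY]) hr (by rwa [hY])
  have hXs := hsp X rfl h
  -- Transposition preserves determinant and cost, so the rows are sparse too.
  have hXs' := hsp Xᵀ (det_transpose X) (by rwa [sqCost_transpose])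
  have hE : (diagonal fun j => ((√(colSq X j) : ℝ) : 𝕜)).IsDiag := isDiag_diagonal _
  obtain ⟨σ, hσ⟩ := exists_perm_norm_eq hXs hXs' (IsDiag.isRectDiag hE) 1 fun j => by
    rw [colSq_of_isDiag hE, diagonal_apply_eq, RCLike.norm_ofReal, sq_abs,
      Real.sq_sqrt (colSq_nonneg _ _)]
    rfl
  have hY : (X.submatrix σ id).IsDiag := fun i j hij => by
    change X.submatrix σ id i j = 0
    rw [← norm_eq_zero]
    refine (hσ i j).trans ?_
    rw [diagonal_apply_ne _ hij, norm_zero]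
  have hp : σ⁻¹.permMatrix 𝕜 * X.submatrix σ id = X := by
    simpa using permMatrix_mul_mul_permMatrix X σ 1
  -- The permutation matrix may have determinant −1. The phases `δ` correct this in W, and their
  -- inverses are absorbed by D.
  obtain ⟨δ, hδ, hδσ⟩ := exists_unimodular_prod_eq (n := n)
    (c := (((Equiv.Perm.sign σ⁻¹ : ℤˣ) : ℤ) : 𝕜))
    (by rcases Int.units_eq_one_or (Equiv.Perm.sign σ⁻¹) with h | h <;> rw [h] <;> simp)
    (by rintro rfl; rw [Subsingleton.elim σ⁻¹ 1]; simp)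
  have hδ0 : ∀ i, δ i ≠ 0 := fun i => norm_ne_zero_iff.1 (by rw [hδ]; exact one_ne_zero)
  obtain ⟨W, hW, hWe⟩ := exists_specialGL (P := σ⁻¹.permMatrix 𝕜 * diagonal δ) (by
    rw [det_mul, det_permutation, det_diagonal, hδσ]
    rcases Int.units_eq_one_or (Equiv.Perm.sign σ⁻¹) with h | h <;> rw [h] <;> simp)
  have hWD : X = (W : Matrix (Fin n) (Fin n) 𝕜) * (diagonal (fun i => (δ i)⁻¹) *
      X.submatrix σ id) := by
    rw [hWe, Matrix.mul_assoc, ← Matrix.mul_assoc (diagonal δ), diagonal_mul_diagonal]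
    simp only [mul_inv_cancel₀ (hδ0 _)]
    rw [diagonal_one, Matrix.one_mul, hp]
  have hDd : (diagonal (fun i => (δ i)⁻¹) * X.submatrix σ id).IsDiag := fun i j hij => by
    change (diagonal (fun i => (δ i)⁻¹) * X.submatrix σ id : Matrix (Fin n) (Fin n) 𝕜) i j = 0
    rw [diagonal_mul, hY hij, mul_zero]
  have hDσ : ∀ j, ‖(diagonal (fun i => (δ i)⁻¹) * X.submatrix σ id : Matrix (Fin n) (Fin n) 𝕜)
      j j‖ = √(colSq X j) := fun j => by
    have h1 := hσ j j
    rw [diagonal_apply_eq, RCLike.norm_ofReal, abs_of_nonneg (Real.sqrt_nonneg _)] at h1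
    rw [diagonal_mul, norm_mul, norm_inv, hδ, inv_one, one_mul]
    exact h1
  set D : Matrix (Fin n) (Fin n) 𝕜 := diagonal (fun i => (δ i)⁻¹) * X.submatrix σ id
  refine ⟨W, hW, D, ⟨σ⁻¹, fun i j => ?_⟩, hDd, hWD, fun hsc i => ?_⟩
  · rw [hWe, mul_diagonal, norm_mul, hδ, mul_one]
  -- Strict convexity makes all columns of X equally long, so the diagonal entries share one
  -- modulus, whose n-th power is that of the determinant.
  · have hnorm : ∀ j, ‖D j j‖ = √(colSq X i) := fun j => by
      rw [hDσ j, colSq_eq_of_sum_colSq_le hm hsc hX hr hrX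
        ((sum_colSq_le_sqCost hg.concaveOn h0 X).trans h) j i]
    have hdet : X.det = ∏ j, D j j := by
      conv_lhs => rw [hWD]
      rw [det_mul, mem_specialGL.1 hW, one_mul, ← hDd.diagonal_diag, det_diagonal]
      simp
    rw [hdet, norm_prod]
    simp [hnorm]

lemma det_act_of_mem_equivGroup {G : GL (Fin n) 𝕜 × GL (Fin n) 𝕜} (hG : G ∈ equivGroup 𝕜 n)
    (M : Matrix (Fin n) (Fin n) 𝕜) : (act G M).det = M.det := by
  rw [act, det_mul, det_mul, det_transpose, mem_specialGL.1 hG.1, mem_specialGL.1 hG.2, one_mul,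
    mul_one]

lemma transposeGL_mem_specialGL {Q : GL (Fin n) 𝕜} (hQ : Q ∈ specialGL 𝕜 n) :
    transposeGL Q ∈ specialGL 𝕜 n :=
  mem_specialGL.2 ((det_transpose _).trans (mem_specialGL.1 hQ))

theorem isMinimizer_equivGroup (hf : StrictConcaveOn ℝ (Set.Ici 0) fun x => f (√x))
    (hf' : MonotoneOn (fun x => f (√x)) (Set.Ici 0))
    (hc : ConvexOn ℝ Set.univ fun x => f (√(Real.exp x)))
    {M : Matrix (Fin n) (Fin n) 𝕜} (hM : M.det ≠ 0) {P Q : GL (Fin n) 𝕜}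
    (hP : P ∈ specialGL 𝕜 n) (hQ : Q ∈ specialGL 𝕜 n) {D : Matrix (Fin n) (Fin n) 𝕜}
    (hD : D.IsDiag) (hd : ∀ i, ‖D i i‖ ^ n = ‖M.det‖)
    (hMD : M = (P : Matrix (Fin n) (Fin n) 𝕜) * D * (Q : Matrix (Fin n) (Fin n) 𝕜)) :
    IsMinimizer (equivGroup 𝕜 n) (cost f) M (transposeGL Q, P)⁻¹ := by
  obtain ⟨r, hr, hrM⟩ := exists_pos_pow_eq_norm_det hM
  have h0 : f (√0) - f 0 = 0 := by rw [Real.sqrt_zero, sub_self]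
  refine ⟨inv_mem ⟨transposeGL_mem_specialGL hQ, hP⟩, fun G hG => ?_⟩
  have hdet := det_act_of_mem_equivGroup hG M
  rw [act_transposeGL_inv, inv_mul_mul_inv_eq hMD, cost_le_cost_iff,
    sqCost_of_isDiag h0 hD hr hrM hd]
  refine (mul_le_sum_colSq (g := fun x => f (√x) - f 0) (monotoneOn_sub_const hf' (f 0))
    (convexOn_sub_const hc (f 0)) (by rwa [hdet]) hr (by rwa [hdet])).trans
    (sum_colSq_le_sqCost (strictConcaveOn_sub_const hf (f 0)).concaveOn h0 _)

theorem exists_of_isMinimizer_equivGroup (hf : StrictConcaveOn ℝ (Set.Ici 0) fun x => f (√x))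
    (hf' : MonotoneOn (fun x => f (√x)) (Set.Ici 0))
    (hc : ConvexOn ℝ Set.univ fun x => f (√(Real.exp x)))
    {M : Matrix (Fin n) (Fin n) 𝕜} (hM : M.det ≠ 0) {P Q : GL (Fin n) 𝕜}
    (hmin : IsMinimizer (equivGroup 𝕜 n) (cost f) M (transposeGL Q, P)⁻¹) :
    ∃ W ∈ specialGL 𝕜 n, ∃ D : Matrix (Fin n) (Fin n) 𝕜,
      IsUnimodularMonomial (W : Matrix (Fin n) (Fin n) 𝕜) ∧ D.IsDiag ∧
      M = ((P : Matrix (Fin n) (Fin n) 𝕜) * (W : Matrix (Fin n) (Fin n) 𝕜)) * D *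
        (Q : Matrix (Fin n) (Fin n) 𝕜) ∧
      (StrictConvexOn ℝ Set.univ (fun x => f (√(Real.exp x))) →
        ∀ i, ‖D i i‖ ^ n = ‖M.det‖) := by
  obtain ⟨r, hr, hrM⟩ := exists_pos_pow_eq_norm_det hM
  have h0 : f (√0) - f 0 = 0 := by rw [Real.sqrt_zero, sub_self]
  obtain ⟨P₀, hP₀, Q₀, hQ₀, D₀, hD₀, hd₀, hMD₀⟩ := exists_equiv_diag hM
  -- Comparison with a decomposition known to attain the lower bound n g(r²).
  have hle := hmin.2 (transposeGL Q₀, P₀)⁻¹ (inv_mem ⟨transposeGL_mem_specialGL hQ₀, hP₀⟩)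
  have hdet := det_act_of_mem_equivGroup hmin.1 M
  rw [act_transposeGL_inv P₀, inv_mul_mul_inv_eq hMD₀, cost_le_cost_iff,
    sqCost_of_isDiag h0 hD₀ hr hrM hd₀] at hle
  obtain ⟨W, hW, D, hWm, hD, hX, hs⟩ := equiv_minimizer (g := fun x => f (√x) - f 0)
    (strictConcaveOn_sub_const hf (f 0)) h0 (monotoneOn_sub_const hf' (f 0))
    (convexOn_sub_const hc (f 0)) (by rwa [hdet]) hr
    (by rwa [hdet]) hle
  refine ⟨W, hW, D, hWm, hD, ?_, fun hsc i => ?_⟩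
  · rw [Matrix.mul_assoc (P : Matrix (Fin n) (Fin n) 𝕜), ← hX, act_transposeGL_inv,
      mul_inv_mul_mul_inv_mul]
  · rw [← hdet]
    exact hs (strictConvexOn_sub_const hsc (f 0)) i

end Equivalence

/-! ### Minimizers of masked costs -/

section Masked

variable {m n : ℕ} {f : ℝ → ℝ}

lemma lowerCost_nonneg (hf : ∀ x, 0 ≤ x → 0 ≤ f x) (X : Matrix (Fin m) (Fin n) 𝕜) :
    0 ≤ lowerCost f X :=
  Finset.sum_nonneg fun _ _ => Finset.sum_nonneg fun _ _ => hf _ (norm_nonneg _)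

lemma lowerCost_eq_zero (hf : ∀ x, 0 ≤ x → 0 ≤ f x) (hf0 : ∀ x, 0 ≤ x → (f x = 0 ↔ x = 0))
    {X : Matrix (Fin m) (Fin n) 𝕜} : lowerCost f X = 0 ↔ IsUpperTri X := by
  rw [lowerCost, Finset.sum_eq_zero_iff_of_nonneg fun _ _ => Finset.sum_nonneg fun _ _ =>
    hf _ (norm_nonneg _)]
  refine forall_congr' fun i => ?_
  rw [Finset.sum_eq_zero_iff_of_nonneg fun _ _ => hf _ (norm_nonneg _)]
  simp only [Finset.mem_univ, true_imp_iff]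
  refine forall_congr' fun j => ?_
  rw [hf0 _ (norm_nonneg _), norm_eq_zero]
  split_ifs with h <;> simp [h]

/-- If the orbit contains an upper triangular matrix, the minimizers of the masked cost are the
elements which triangularize. -/
lemma isMinimizer_lowerCost_iff (hf : ∀ x, 0 ≤ x → 0 ≤ f x)
    (hf0 : ∀ x, 0 ≤ x → (f x = 0 ↔ x = 0))
    {H : Subgroup (GL (Fin n) 𝕜 × GL (Fin m) 𝕜)} {M : Matrix (Fin m) (Fin n) 𝕜}
    {G₀ G : GL (Fin n) 𝕜 × GL (Fin m) 𝕜} (hG₀ : G₀ ∈ H) (h₀ : IsUpperTri (act G₀ M))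
    (hG : G ∈ H) : IsMinimizer H (lowerCost f) M G ↔ IsUpperTri (act G M) := by
  rw [← lowerCost_eq_zero hf hf0] at h₀ ⊢
  exact ⟨fun h => le_antisymm (h₀ ▸ h.2 G₀ hG₀) (lowerCost_nonneg hf _),
    fun h => ⟨hG, fun G' _ => h ▸ lowerCost_nonneg hf _⟩⟩

lemma IsUpperTri.mul {X : Matrix (Fin m) (Fin n) 𝕜} (hX : IsUpperTri X)
    {Y : Matrix (Fin n) (Fin n) 𝕜} (hY : IsUpperTri Y) : IsUpperTri (X * Y) := by
  intro i j hij
  rw [mul_apply]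
  refine Finset.sum_eq_zero fun k _ => ?_
  rcases lt_or_ge (k : ℕ) i with h | h
  · rw [hX i k h, zero_mul]
  · rw [hY k j (hij.trans_le h), mul_zero]

lemma IsRectDiag.isUpperTri {D : Matrix (Fin m) (Fin n) 𝕜} (hD : IsRectDiag D) : IsUpperTri D :=
  fun i j h => hD i j h.ne'

lemma act_one_inv (L : GL (Fin m) 𝕜) (M : Matrix (Fin m) (Fin n) 𝕜) :
    act ((1 : GL (Fin n) 𝕜), L)⁻¹ M =
      ((L⁻¹ : GL (Fin m) 𝕜) : Matrix (Fin m) (Fin m) 𝕜) * M := by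
  change _ * M * (((1 : GL (Fin n) 𝕜)⁻¹ : GL (Fin n) 𝕜) : Matrix (Fin n) (Fin n) 𝕜)ᵀ = _
  rw [inv_one, Units.val_one, transpose_one, Matrix.mul_one]
  rfl

lemma inv_mem_luGroup {L : GL (Fin m) 𝕜} (hL : L ∈ lowerUnitGL 𝕜 m) :
    ((1 : GL (Fin n) 𝕜), L)⁻¹ ∈ luGroup 𝕜 m n :=
  inv_mem ⟨one_mem _, hL⟩

lemma eq_mul_iff {L : GL (Fin m) 𝕜} {M T : Matrix (Fin m) (Fin n) 𝕜} :
    M = (L : Matrix (Fin m) (Fin m) 𝕜) * T ↔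
      ((L⁻¹ : GL (Fin m) 𝕜) : Matrix (Fin m) (Fin m) 𝕜) * M = T := by
  constructor <;> rintro rfl
  · rw [← Matrix.mul_assoc, Units.inv_mul, Matrix.one_mul]
  · rw [← Matrix.mul_assoc, Units.mul_inv, Matrix.one_mul]

theorem lu_isMinimizer_iff (hf : ∀ x, 0 ≤ x → 0 ≤ f x) (hf0 : ∀ x, 0 ≤ x → (f x = 0 ↔ x = 0))
    {M : Matrix (Fin m) (Fin n) 𝕜} {L : GL (Fin m) 𝕜} (hL : L ∈ lowerUnitGL 𝕜 m)
    {T : Matrix (Fin m) (Fin n) 𝕜} (hT : IsUpperTri T)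
    (hM : M = (L : Matrix (Fin m) (Fin m) 𝕜) * T) {L' : GL (Fin m) 𝕜}
    (hL' : L' ∈ lowerUnitGL 𝕜 m) :
    IsMinimizer (luGroup 𝕜 m n) (lowerCost f) M (1, L')⁻¹ ↔
      ∃ T' : Matrix (Fin m) (Fin n) 𝕜, IsUpperTri T' ∧
        M = (L' : Matrix (Fin m) (Fin m) 𝕜) * T' := by
  rw [isMinimizer_lowerCost_iff hf hf0 (inv_mem_luGroup hL)
    (by rwa [act_one_inv, eq_mul_iff.1 hM]) (inv_mem_luGroup hL'), act_one_inv]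
  simp only [eq_mul_iff, exists_eq_right']

/-- On and above the diagonal, `K * D` agrees with `D` because K is lower triangular with unit
diagonal; below it, both vanish. This is what lets D and U be kept for every minimizer. -/
lemma lower_unit_mul_diag_eq {K : GL (Fin m) 𝕜} (hK : K ∈ lowerUnitGL 𝕜 m)
    {D : Matrix (Fin m) (Fin n) 𝕜} (hD : IsRectDiag D)
    (hKD : IsUpperTri ((K : Matrix (Fin m) (Fin m) 𝕜) * D)) :
    (K : Matrix (Fin m) (Fin m) 𝕜) * D = D := by
  ext i j
  rcases lt_or_ge (j : ℕ) i with h | h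
  · rw [hKD i j h, hD i j h.ne']
  · rw [mul_apply, Finset.sum_eq_single i (fun k _ hk => ?_) (by simp)]
    · rw [show (K : Matrix (Fin m) (Fin m) 𝕜) i i = 1 from hK.2 i, one_mul]
    · rcases lt_or_gt_of_ne hk with h1 | h1
      · have h1' : (k : ℕ) < i := h1
        rw [hD k j (by omega), mul_zero]
      · rw [show (K : Matrix (Fin m) (Fin m) 𝕜) i k = 0 from hK.1 k i h1, zero_mul]

theorem ldu_minimizer (hf : ∀ x, 0 ≤ x → 0 ≤ f x) (hf0 : ∀ x, 0 ≤ x → (f x = 0 ↔ x = 0))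
    {M : Matrix (Fin m) (Fin n) 𝕜} {L : GL (Fin m) 𝕜} (hL : L ∈ lowerUnitGL 𝕜 m)
    {U : GL (Fin n) 𝕜} (hU : U ∈ upperUnitGL 𝕜 n) {D : Matrix (Fin m) (Fin n) 𝕜}
    (hD : IsRectDiag D)
    (hM : M = (L : Matrix (Fin m) (Fin m) 𝕜) * D * (U : Matrix (Fin n) (Fin n) 𝕜)) :
    IsMinimizer (luGroup 𝕜 m n) (lowerCost f) M (1, L)⁻¹ ∧
      ∀ L' ∈ lowerUnitGL 𝕜 m, IsMinimizer (luGroup 𝕜 m n) (lowerCost f) M (1, L')⁻¹ →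
        M = (L' : Matrix (Fin m) (Fin m) 𝕜) * D * (U : Matrix (Fin n) (Fin n) 𝕜) := by
  have hT : IsUpperTri (D * (U : Matrix (Fin n) (Fin n) 𝕜)) := hD.isUpperTri.mul hU.1
  rw [Matrix.mul_assoc] at hM
  refine ⟨(lu_isMinimizer_iff hf hf0 hL hT hM hL).2 ⟨_, hT, hM⟩, fun L' hL' hmin => ?_⟩
  obtain ⟨T', hT', hM'⟩ := (lu_isMinimizer_iff hf hf0 hL hT hM hL').1 hmin
  have hK : L'⁻¹ * L ∈ lowerUnitGL 𝕜 m := mul_mem (inv_mem hL') hL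
  have h1 := eq_mul_iff.1 hM'
  have hKD : ((L'⁻¹ * L : GL (Fin m) 𝕜) : Matrix (Fin m) (Fin m) 𝕜) * D =
      T' * ((U⁻¹ : GL (Fin n) 𝕜) : Matrix (Fin n) (Fin n) 𝕜) := by
    rw [← h1, hM, Units.val_mul]
    simp only [Matrix.mul_assoc]
    rw [Units.mul_inv, Matrix.mul_one]
  -- `K * D = T' * U⁻¹` is upper triangular, so K = L'⁻¹ L fixes D.
  have h2 := lower_unit_mul_diag_eq hK hD (by rw [hKD]; exact hT'.mul (upper_inv hU.1))
  rw [Matrix.mul_assoc, eq_mul_iff]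
  refine Eq.trans ?_ (congrArg (· * (U : Matrix (Fin n) (Fin n) 𝕜)) h2)
  rw [hM, Units.val_mul]
  simp only [Matrix.mul_assoc]

lemma conjTranspose_isUpperTri {L : GL (Fin n) 𝕜} (hL : L ∈ lowerUnitGL 𝕜 n) :
    IsUpperTri (L : Matrix (Fin n) (Fin n) 𝕜)ᴴ := fun i j h => by
  rw [conjTranspose_apply, show (L : Matrix (Fin n) (Fin n) 𝕜) j i = 0 from hL.1 i j h, star_zero]

lemma diagonal_isUpperTri (d : Fin n → 𝕜) : IsUpperTri (diagonal d) := fun i j h =>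
  diagonal_apply_ne _ fun e => by subst e; exact lt_irrefl _ h

/-- Every positive definite matrix is a product of a lower triangular matrix with unit diagonal
and an upper triangular matrix. -/
lemma exists_lu_of_posDef {M : Matrix (Fin n) (Fin n) 𝕜} (hM : M.PosDef) :
    ∃ L ∈ lowerUnitGL 𝕜 n, ∃ T : Matrix (Fin n) (Fin n) 𝕜, IsUpperTri T ∧
      M = (L : Matrix (Fin n) (Fin n) 𝕜) * T := by
  obtain ⟨B, rfl⟩ := exists_eq_conjTranspose_mul_self hM
  obtain ⟨Q, hQ, D, R, hD, hR, h1, rfl⟩ := exists_qdr le_rfl B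
  -- With B = QDR one has BᴴB = Rᴴ(DᴴDR). The lower factor Rᴴ is the transpose of the conjugate of
  -- R.
  obtain ⟨g, hg, hgR⟩ := exists_upperUnitGL (R := Rᴴᵀ)
    (fun i j h => by rw [transpose_apply, conjTranspose_apply, hR i j h, star_zero])
    (fun i => by rw [transpose_apply, conjTranspose_apply, h1, star_one])
  refine ⟨transposeGL g, transposeGL_mem_lowerUnitGL.2 hg, Dᴴ * D * R, ?_, ?_⟩
  · rw [gram_eq_diagonal hD.transpose.colSparse]
    exact (diagonal_isUpperTri _).mul hR
  · have : (transposeGL g : Matrix (Fin n) (Fin n) 𝕜) = Rᴴ := congrArg transpose hgR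
    rw [this, Matrix.mul_assoc, gram_unitary_mul hQ, conjTranspose_mul]
    simp only [Matrix.mul_assoc]

/-- If L⁻¹M is upper triangular, then so is L⁻¹M(L⁻¹)ᴴ. Being Hermitian, it is diagonal, and it is
positive by congruence with M. -/
theorem cholesky_isMinimizer_iff (hf : ∀ x, 0 ≤ x → 0 ≤ f x)
    (hf0 : ∀ x, 0 ≤ x → (f x = 0 ↔ x = 0)) {M : Matrix (Fin n) (Fin n) 𝕜} (hM : M.PosDef)
    {L : GL (Fin n) 𝕜} (hL : L ∈ lowerUnitGL 𝕜 n) :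
    IsMinimizer (luGroup 𝕜 n n) (lowerCost f) M (1, L)⁻¹ ↔
      ∃ d : Fin n → ℝ, (∀ i, 0 < d i) ∧
        M = (L : Matrix (Fin n) (Fin n) 𝕜) * diagonal (fun i => (d i : 𝕜)) *
          (L : Matrix (Fin n) (Fin n) 𝕜)ᴴ := by
  obtain ⟨L₀, hL₀, T₀, hT₀, hM₀⟩ := exists_lu_of_posDef hM
  rw [lu_isMinimizer_iff hf hf0 hL₀ hT₀ hM₀ hL]
  constructor
  · rintro ⟨T, hT, hMT⟩
    set K : Matrix (Fin n) (Fin n) 𝕜 := ((L⁻¹ : GL (Fin n) 𝕜) : Matrix (Fin n) (Fin n) 𝕜) with hK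
    have hLK : (L : Matrix (Fin n) (Fin n) 𝕜) * K = 1 := Units.mul_inv L
    have hKL : Kᴴ * (L : Matrix (Fin n) (Fin n) 𝕜)ᴴ = 1 := by
      rw [← conjTranspose_mul, hLK, conjTranspose_one]
    have hLK' : (L : Matrix (Fin n) (Fin n) 𝕜)ᴴ * Kᴴ = 1 := mul_eq_one_comm.1 hKL
    have hN : (K * M * Kᴴ).PosDef := by
      have h := hM.conjTranspose_mul_mul_same (B := Kᴴ) fun x y hxy => by
        have := congrArg ((L : Matrix (Fin n) (Fin n) 𝕜)ᴴ.mulVec) hxy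
        simpa only [mulVec_mulVec, hLK', one_mulVec] using this
      rwa [conjTranspose_conjTranspose] at h
    have hNT : IsUpperTri (K * M * Kᴴ) := by
      rw [hK, eq_mul_iff.1 hMT]
      exact hT.mul (conjTranspose_isUpperTri (inv_mem hL))
    have hNd : K * M * Kᴴ = diagonal fun i => ((RCLike.re ((K * M * Kᴴ) i i) : ℝ) : 𝕜) := by
      ext i j
      rcases lt_trichotomy i j with h | rfl | h
      · rw [diagonal_apply_ne _ h.ne, ← hN.1.apply, hNT j i h, star_zero]
      · rw [diagonal_apply_eq]
        exact (RCLike.conj_eq_iff_re.1 (hN.1.apply i i)).symm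
      · rw [diagonal_apply_ne _ h.ne', hNT i j h]
    refine ⟨_, fun i => (RCLike.pos_iff.1 (hN.diag_pos (i := i))).1, ?_⟩
    rw [← hNd]
    simp only [Matrix.mul_assoc, hKL, Matrix.mul_one]
    rw [← Matrix.mul_assoc, hLK, Matrix.one_mul]
  · rintro ⟨d, -, h⟩
    exact ⟨_, (diagonal_isUpperTri _).mul (conjTranspose_isUpperTri hL),
      by rw [← Matrix.mul_assoc]; exact h⟩

theorem schur_isMinimizer_iff (hf : ∀ x, 0 ≤ x → 0 ≤ f x)
    (hf0 : ∀ x, 0 ≤ x → (f x = 0 ↔ x = 0)) (M : Matrix (Fin n) (Fin n) ℂ)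
    {Q : GL (Fin n) ℂ} (hQ : Q ∈ unitaryGL ℂ n) :
    IsMinimizer (schurGroup ℂ n) (lowerCost f) M (conjGL Q, Q)⁻¹ ↔
      IsUpperTri ((Q : Matrix (Fin n) (Fin n) ℂ)ᴴ * M * (Q : Matrix (Fin n) (Fin n) ℂ)) := by
  have hmem : ∀ Q ∈ unitaryGL ℂ n, (conjGL Q, Q)⁻¹ ∈ schurGroup ℂ n := fun Q hQ =>
    inv_mem ⟨Q, hQ, rfl⟩
  obtain ⟨_, hU, h⟩ := exists_schur M
  obtain ⟨Q₀, hQ₀, rfl⟩ := exists_unitaryGL hU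
  rw [isMinimizer_lowerCost_iff hf hf0 (hmem Q₀ hQ₀) (by rwa [act_conjGL_inv hQ₀ hQ₀])
    (hmem Q hQ), act_conjGL_inv hQ hQ]

lemma schur_form_iff {Q : GL (Fin n) 𝕜} (hQ : Q ∈ unitaryGL 𝕜 n) (M : Matrix (Fin n) (Fin n) 𝕜) :
    IsUpperTri ((Q : Matrix (Fin n) (Fin n) 𝕜)ᴴ * M * (Q : Matrix (Fin n) (Fin n) 𝕜)) ↔
      ∃ T : Matrix (Fin n) (Fin n) 𝕜, IsUpperTri T ∧
        M = (Q : Matrix (Fin n) (Fin n) 𝕜) * T * (Q : Matrix (Fin n) (Fin n) 𝕜)ᴴ := by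
  rw [← coe_inv_of_mem_unitaryGL hQ]
  constructor
  · intro h
    refine ⟨_, h, ?_⟩
    have := mul_inv_mul_mul_inv_mul Q Q⁻¹ M
    rwa [inv_inv, eq_comm] at this
  · rintro ⟨T, hT, h⟩
    have := inv_mul_mul_inv_eq (Q := Q⁻¹) h
    rw [inv_inv] at this
    rwa [this]

end Masked

end

end GOO

/-! ### The full theorem, assembled from its parts. -/

theorem mainTheorem1 {𝕜 : Type*} [RCLike 𝕜] :
    -- the groups that occur are unit groups
    (∀ m n : ℕ,
      GOO.IsUnitGroup ((GOO.svdGroup 𝕜 m n).map GOO.kroneckerGL) ∧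
      GOO.IsUnitGroup ((GOO.qrGroup 𝕜 m n).map GOO.kroneckerGL) ∧
      GOO.IsUnitGroup ((GOO.equivGroup 𝕜 n).map GOO.kroneckerGL) ∧
      GOO.IsUnitGroup ((GOO.luGroup 𝕜 m n).map GOO.kroneckerGL) ∧
      GOO.IsUnitGroup ((GOO.schurGroup 𝕜 n).map GOO.kroneckerGL)) ∧
    -- singular value decomposition `M = U D Vᴴ`, real (`𝕜 = ℝ`) and complex (`𝕜 = ℂ`)
    (∀ (m n : ℕ) (f : ℝ → ℝ), StrictConcaveOn ℝ (Set.Ici 0) (fun x => f (√x)) → 0 ≤ f 0 →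
      ∀ M : Matrix (Fin m) (Fin n) 𝕜,
        (∃ U ∈ GOO.unitaryGL 𝕜 m, ∃ V ∈ GOO.unitaryGL 𝕜 n, ∃ S : Matrix (Fin m) (Fin n) ℝ,
          GOO.IsRectDiag S ∧ (∀ i j, 0 ≤ S i j) ∧
          M = (U : Matrix (Fin m) (Fin m) 𝕜) * S.map (fun x : ℝ => (x : 𝕜)) *
            (V : Matrix (Fin n) (Fin n) 𝕜)ᴴ) ∧
        (∀ U ∈ GOO.unitaryGL 𝕜 m, ∀ V ∈ GOO.unitaryGL 𝕜 n, ∀ D : Matrix (Fin m) (Fin n) 𝕜,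
          GOO.IsRectDiag D →
          M = (U : Matrix (Fin m) (Fin m) 𝕜) * D * (V : Matrix (Fin n) (Fin n) 𝕜)ᴴ →
          GOO.IsMinimizer (GOO.svdGroup 𝕜 m n) (GOO.cost f) M (GOO.conjGL V, U)⁻¹ ∧
          ∀ U' ∈ GOO.unitaryGL 𝕜 m, ∀ V' ∈ GOO.unitaryGL 𝕜 n,
            GOO.IsMinimizer (GOO.svdGroup 𝕜 m n) (GOO.cost f) M (GOO.conjGL V', U')⁻¹ →
            ∃ (σ : Equiv.Perm (Fin m)) (τ : Equiv.Perm (Fin n)) (Z : Matrix (Fin m) (Fin n) 𝕜),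
              GOO.IsRectDiag Z ∧ (∀ i j, ‖Z i j‖ = ‖D i j‖) ∧
              M = ((U' : Matrix (Fin m) (Fin m) 𝕜) * σ.permMatrix 𝕜) * Z *
                ((V' : Matrix (Fin n) (Fin n) 𝕜) * τ.permMatrix 𝕜)ᴴ)) ∧
    -- QR decomposition `M = Q D R`
    (∀ (m n : ℕ) (f : ℝ → ℝ), StrictConcaveOn ℝ (Set.Ici 0) (fun x => f (√x)) →
      MonotoneOn (fun x => f (√x)) (Set.Ici 0) → 0 ≤ f 0 →
      ∀ M : Matrix (Fin m) (Fin n) 𝕜,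
        (n ≤ m → ∃ Q ∈ GOO.unitaryGL 𝕜 m, ∃ R ∈ GOO.upperUnitGL 𝕜 n,
          ∃ D : Matrix (Fin m) (Fin n) 𝕜, GOO.IsRectDiag D ∧
          M = (Q : Matrix (Fin m) (Fin m) 𝕜) * D * (R : Matrix (Fin n) (Fin n) 𝕜)) ∧
        (∀ Q ∈ GOO.unitaryGL 𝕜 m, ∀ R ∈ GOO.upperUnitGL 𝕜 n, ∀ D : Matrix (Fin m) (Fin n) 𝕜,
          GOO.IsRectDiag D →
          M = (Q : Matrix (Fin m) (Fin m) 𝕜) * D * (R : Matrix (Fin n) (Fin n) 𝕜) →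
          GOO.IsMinimizer (GOO.qrGroup 𝕜 m n) (GOO.cost f) M (GOO.transposeGL R, Q)⁻¹ ∧
          ∀ Q' ∈ GOO.unitaryGL 𝕜 m, ∀ R' ∈ GOO.upperUnitGL 𝕜 n,
            GOO.IsMinimizer (GOO.qrGroup 𝕜 m n) (GOO.cost f) M (GOO.transposeGL R', Q')⁻¹ →
            ∃ (σ : Equiv.Perm (Fin m)) (Z : Matrix (Fin m) (Fin n) 𝕜),
              GOO.IsRectDiag Z ∧ (∀ i j, ‖Z i j‖ = ‖D i j‖) ∧
              M = ((Q' : Matrix (Fin m) (Fin m) 𝕜) * σ.permMatrix 𝕜) * Z *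
                (R' : Matrix (Fin n) (Fin n) 𝕜))) ∧
    -- matrix equivalence `M = P D Q` of an invertible matrix
    (∀ (n : ℕ) (f : ℝ → ℝ), StrictConcaveOn ℝ (Set.Ici 0) (fun x => f (√x)) →
      MonotoneOn (fun x => f (√x)) (Set.Ici 0) →
      ConvexOn ℝ Set.univ (fun x => f (√(Real.exp x))) → 0 ≤ f 0 →
      ∀ M : Matrix (Fin n) (Fin n) 𝕜, IsUnit M →
        (∃ P ∈ GOO.specialGL 𝕜 n, ∃ Q ∈ GOO.specialGL 𝕜 n, ∃ D : Matrix (Fin n) (Fin n) 𝕜,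
          D.IsDiag ∧ (∀ i, ‖D i i‖ ^ n = ‖M.det‖) ∧
          M = (P : Matrix (Fin n) (Fin n) 𝕜) * D * (Q : Matrix (Fin n) (Fin n) 𝕜)) ∧
        (∀ c : 𝕜, c ^ n = M.det → ∃ P ∈ GOO.specialGL 𝕜 n, ∃ Q ∈ GOO.specialGL 𝕜 n,
          M = (P : Matrix (Fin n) (Fin n) 𝕜) * (c • (1 : Matrix (Fin n) (Fin n) 𝕜)) *
            (Q : Matrix (Fin n) (Fin n) 𝕜)) ∧
        (∀ P ∈ GOO.specialGL 𝕜 n, ∀ Q ∈ GOO.specialGL 𝕜 n, ∀ D : Matrix (Fin n) (Fin n) 𝕜,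
          D.IsDiag → (∀ i, ‖D i i‖ ^ n = ‖M.det‖) →
          M = (P : Matrix (Fin n) (Fin n) 𝕜) * D * (Q : Matrix (Fin n) (Fin n) 𝕜) →
          GOO.IsMinimizer (GOO.equivGroup 𝕜 n) (GOO.cost f) M (GOO.transposeGL Q, P)⁻¹) ∧
        (∀ P ∈ GOO.specialGL 𝕜 n, ∀ Q ∈ GOO.specialGL 𝕜 n,
          GOO.IsMinimizer (GOO.equivGroup 𝕜 n) (GOO.cost f) M (GOO.transposeGL Q, P)⁻¹ →
          ∃ W ∈ GOO.specialGL 𝕜 n, ∃ D : Matrix (Fin n) (Fin n) 𝕜,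
            GOO.IsUnimodularMonomial (W : Matrix (Fin n) (Fin n) 𝕜) ∧ D.IsDiag ∧
            M = ((P : Matrix (Fin n) (Fin n) 𝕜) * (W : Matrix (Fin n) (Fin n) 𝕜)) * D *
              (Q : Matrix (Fin n) (Fin n) 𝕜) ∧
            (StrictConvexOn ℝ Set.univ (fun x => f (√(Real.exp x))) →
              ∀ i, ‖D i i‖ ^ n = ‖M.det‖))) ∧
    -- the masked costs of the triangular forms
    (∀ f : ℝ → ℝ, (∀ x, 0 ≤ x → 0 ≤ f x) → (∀ x, 0 ≤ x → (f x = 0 ↔ x = 0)) →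
      -- LU decomposition `M = L T` and `M = L D U`
      (∀ (m n : ℕ) (M : Matrix (Fin m) (Fin n) 𝕜),
        (∀ L ∈ GOO.lowerUnitGL 𝕜 m, ∀ T : Matrix (Fin m) (Fin n) 𝕜, GOO.IsUpperTri T →
          M = (L : Matrix (Fin m) (Fin m) 𝕜) * T →
          ∀ L' ∈ GOO.lowerUnitGL 𝕜 m,
            (GOO.IsMinimizer (GOO.luGroup 𝕜 m n) (GOO.lowerCost f) M (1, L')⁻¹ ↔
              ∃ T' : Matrix (Fin m) (Fin n) 𝕜, GOO.IsUpperTri T' ∧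
                M = (L' : Matrix (Fin m) (Fin m) 𝕜) * T')) ∧
        (∀ L ∈ GOO.lowerUnitGL 𝕜 m, ∀ U ∈ GOO.upperUnitGL 𝕜 n,
          ∀ D : Matrix (Fin m) (Fin n) 𝕜, GOO.IsRectDiag D →
          M = (L : Matrix (Fin m) (Fin m) 𝕜) * D * (U : Matrix (Fin n) (Fin n) 𝕜) →
          GOO.IsMinimizer (GOO.luGroup 𝕜 m n) (GOO.lowerCost f) M (1, L)⁻¹ ∧
          ∀ L' ∈ GOO.lowerUnitGL 𝕜 m,
            GOO.IsMinimizer (GOO.luGroup 𝕜 m n) (GOO.lowerCost f) M (1, L')⁻¹ →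
            M = (L' : Matrix (Fin m) (Fin m) 𝕜) * D * (U : Matrix (Fin n) (Fin n) 𝕜))) ∧
      -- Cholesky decomposition `M = L D Lᴴ` of a positive definite matrix
      (∀ (n : ℕ) (M : Matrix (Fin n) (Fin n) 𝕜), M.PosDef →
        (∃ L ∈ GOO.lowerUnitGL 𝕜 n,
          GOO.IsMinimizer (GOO.luGroup 𝕜 n n) (GOO.lowerCost f) M (1, L)⁻¹) ∧
        ∀ L ∈ GOO.lowerUnitGL 𝕜 n,
          (GOO.IsMinimizer (GOO.luGroup 𝕜 n n) (GOO.lowerCost f) M (1, L)⁻¹ ↔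
            ∃ d : Fin n → ℝ, (∀ i, 0 < d i) ∧
              M = (L : Matrix (Fin n) (Fin n) 𝕜) * Matrix.diagonal (fun i => (d i : 𝕜)) *
                (L : Matrix (Fin n) (Fin n) 𝕜)ᴴ)) ∧
      -- Schur decomposition `M = Q T Qᴴ` of a complex matrix
      (∀ (n : ℕ) (M : Matrix (Fin n) (Fin n) ℂ),
        (∃ Q ∈ GOO.unitaryGL ℂ n,
          GOO.IsMinimizer (GOO.schurGroup ℂ n) (GOO.lowerCost f) M (GOO.conjGL Q, Q)⁻¹) ∧
        ∀ Q ∈ GOO.unitaryGL ℂ n,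
          (GOO.IsMinimizer (GOO.schurGroup ℂ n) (GOO.lowerCost f) M (GOO.conjGL Q, Q)⁻¹ ↔
            ∃ T : Matrix (Fin n) (Fin n) ℂ, GOO.IsUpperTri T ∧
              M = (Q : Matrix (Fin n) (Fin n) ℂ) * T *
                (Q : Matrix (Fin n) (Fin n) ℂ)ᴴ))) := by
  refine ⟨GOO.isUnitGroups 𝕜, fun m n f hf _ M => ⟨?_, ?_⟩, fun m n f hf hf' _ M => ⟨?_, ?_⟩,
    fun n f hf hf' hc _ M hM => ?_, fun f hf hf0 => ⟨fun m n M => ⟨?_, ?_⟩, fun n M hM => ⟨?_, ?_⟩,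
    fun n M => ⟨?_, ?_⟩⟩⟩
  · obtain ⟨_, hU', _, hV', S, hS, hS0, h⟩ := GOO.exists_svd M
    obtain ⟨U, hU, rfl⟩ := GOO.exists_unitaryGL hU'
    obtain ⟨V, hV, rfl⟩ := GOO.exists_unitaryGL hV'
    exact ⟨U, hU, V, hV, S, hS, hS0, h⟩
  · exact fun U hU V hV D hD h => GOO.svd_minimizer hf hU hV hD h
  · intro hnm
    obtain ⟨_, hQ', D, _, hD, hR', h1, h⟩ := GOO.exists_qdr hnm M
    obtain ⟨Q, hQ, rfl⟩ := GOO.exists_unitaryGL hQ'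
    obtain ⟨R, hR, rfl⟩ := GOO.exists_upperUnitGL hR' h1
    exact ⟨Q, hQ, R, hR, D, hD, h⟩
  · exact fun Q hQ R hR D hD h => GOO.qr_minimizer hf hf' hQ hR hD h
  · have hdet : M.det ≠ 0 := ((Matrix.isUnit_iff_isUnit_det M).1 hM).ne_zero
    exact ⟨GOO.exists_equiv_diag hdet,
      fun c hcM => GOO.exists_specialGL_mul hdet (by simpa [Matrix.det_smul] using hcM),
      fun P hP Q hQ D hD hd h => GOO.isMinimizer_equivGroup hf hf' hc hdet hP hQ hD hd h,
      fun P _ Q _ h => GOO.exists_of_isMinimizer_equivGroup hf hf' hc hdet h⟩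
  · exact fun L hL T hT h L' hL' => GOO.lu_isMinimizer_iff hf hf0 hL hT h hL'
  · exact fun L hL U hU D hD h => GOO.ldu_minimizer hf hf0 hL hU hD h
  · obtain ⟨L, hL, T, hT, h⟩ := GOO.exists_lu_of_posDef hM
    exact ⟨L, hL, (GOO.lu_isMinimizer_iff hf hf0 hL hT h hL).2 ⟨T, hT, h⟩⟩
  · exact fun L hL => GOO.cholesky_isMinimizer_iff hf hf0 hM hL
  · obtain ⟨_, hQ', h⟩ := GOO.exists_schur M
    obtain ⟨Q, hQ, rfl⟩ := GOO.exists_unitaryGL hQ'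
    exact ⟨Q, hQ, (GOO.schur_isMinimizer_iff hf hf0 M hQ).2 h⟩
  · exact fun Q hQ => (GOO.schur_isMinimizer_iff hf hf0 M hQ).trans (GOO.schur_form_iff hQ M)
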